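/- Let $\mathfrak S_n$ be the set of permutations of $\{1,\dots,n\}$, written in one-line notation $\pi=\pi_1\pi_2\cdots\pi_n$; write $|\pi|=n$, and let $1$ also denote the permutation of size $1$. A permutation is $312$-avoiding if it has no subsequence order isomorphic to $312$. For permutations $\alpha,\beta$, possibly empty, of sizes $a,b$, let $12[\alpha,\beta]$ (respectively $21[\alpha,\beta]$) be the permutation of size $a+b$ whose first $a$ entries are the $a$ smallest (respectively largest) values, in the relative order of $\alpha$, and whose last $b$ entries are the $b$ largest (respectively smallest) values, in the relative order of $\beta$. A reduced word of $\pi\in\mathfrak S_n$ is a word $i_1i_2\cdots i_k$ in the letters $1,\dots,n-1$ with $\pi=s_{i_1}s_{i_2}\cdots s_{i_k}$ and $k$ minimal, where $s_i$ is the transposition of $i$ and $i+1$; this minimal $k$ is the length $\ell(\pi)$, and $R(\pi)$ is the set of reduced words of $\pi$. Let $G_\pi$ be the graph on $R(\pi)$ whose edges are the commutation moves (switching two adjacent letters $j,k$ with $|j-k|>1$) and the long braid moves (replacing consecutive letters $j\,(j+1)\,j$ by $(j+1)\,j\,(j+1)$, or conversely). Let $C_\pi$ (respectively $B_\pi$)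 be the simple graph obtained from $G_\pi$ by contracting all commutation edges (respectively all long braid edges). **Theorem.** Let $n\ge 1$, let $\pi\in\mathfrak S_n$ be $312$-avoiding, and let $m\in\{1,\dots,n\}$ be the index with $\pi_m=1$. Then $$\pi=12[21[\pi',1],\pi'']$$ for two $312$-avoiding permutations $\pi'$ and $\pi''$ with $|\pi'|=m-1$ and $|\pi''|=n-m$. The graphs $G_\sigma,C_\sigma,B_\sigma$ are connected for each $\sigma\in\{\pi,\pi',\pi''\}$, and their diameters satisfy 1. $\operatorname{diam}(G_\pi)=\operatorname{diam}(G_{\pi'})+\operatorname{diam}(G_{\pi''})+(m-1)(\ell(\pi')+\ell(\pi''))+\ell(\pi')(\ell(\pi'')-1)$, 2. $\operatorname{diam}(C_\pi)=\operatorname{diam}(C_{\pi'})+\operatorname{diam}(C_{\pi''})+\ell(\pi')$, 3. $\operatorname{diam}(B_\pi)=\operatorname{diam}(B_{\pi'})+\operatorname{diam}(B_{\pi''})+(m-1)(\ell(\pi')+\ell(\pi''))+\ell(\pi')(\ell(\pi'')-2)$. -/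

import Mathlib

/-! Permutations of size `n` are elements of `Equiv.Perm (Fin n)`.  Positions and values of a
permutation are `0, …, n - 1` here (so the value "1" of one-line notation is `0 : Fin n`), while
letters of words are the natural numbers `1, …, n - 1`. -/

namespace WordGraph

/-! ### Patterns and inflations -/

/-- `π` contains the pattern `σ`: some subsequence of `π` is order isomorphic to `σ`. -/
def Contains {k n : ℕ} (π : Equiv.Perm (Fin n)) (σ : Equiv.Perm (Fin k)) : Prop :=
  ∃ e : Fin k ↪o Fin n, ∀ i j : Fin k, π (e i) ≤ π (e j) ↔ σ i ≤ σ j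

/-- `π` avoids the pattern `σ`. -/
def Avoids {k n : ℕ} (π : Equiv.Perm (Fin n)) (σ : Equiv.Perm (Fin k)) : Prop :=
  ¬ Contains π σ

/-- The permutation `312`. -/
def perm312 : Equiv.Perm (Fin 3) where
  toFun := ![2, 0, 1]
  invFun := ![1, 2, 0]
  left_inv := by decide
  right_inv := by decide

/-- The inflation `12[α, β]`: the first `a` positions carry a copy of `α` on the `a` smallest
values, the last `b` positions a copy of `β` on the `b` largest values. -/
def inflate12 {a b : ℕ} (α : Equiv.Perm (Fin a)) (β : Equiv.Perm (Fin b)) :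
    Equiv.Perm (Fin (a + b)) :=
  (finSumFinEquiv.symm.trans (Equiv.sumCongr α β)).trans finSumFinEquiv

/-- The inflation `21[α, β]`: the first `a` positions carry a copy of `α` on the `a` largest
values, the last `b` positions a copy of `β` on the `b` smallest values. -/
def inflate21 {a b : ℕ} (α : Equiv.Perm (Fin a)) (β : Equiv.Perm (Fin b)) :
    Equiv.Perm (Fin (a + b)) :=
  (((finSumFinEquiv.symm.trans (Equiv.sumCongr α β)).trans (Equiv.sumComm _ _)).trans
    finSumFinEquiv).trans (finCongr (Nat.add_comm b a))

/-- The same permutation, regarded as a permutation of size `n` when its size is written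
differently. -/
def resize {k n : ℕ} (h : k = n) (π : Equiv.Perm (Fin k)) : Equiv.Perm (Fin n) :=
  (finCongr h).permCongr π

/-! ### Reduced words -/

/-- The simple reflection `s_i` of `𝔖_n`, `1 ≤ i ≤ n - 1`, which interchanges the `i`-th and the
`(i + 1)`-st element.  (The value for other `i` is never used.) -/
def simple (n i : ℕ) : Equiv.Perm (Fin n) :=
  if h : 1 ≤ i ∧ i < n then Equiv.swap ⟨i - 1, by omega⟩ ⟨i, h.2⟩ else 1

/-- The word `i₁ i₂ … i_k` has letters in `{1, …, n - 1}` and `π = s_{i₁} s_{i₂} ⋯ s_{i_k}`. -/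
def IsWord {n : ℕ} (π : Equiv.Perm (Fin n)) (w : List ℕ) : Prop :=
  (∀ i ∈ w, 1 ≤ i ∧ i < n) ∧ (w.map (simple n)).prod = π

/-- `w` is a reduced word of `π`: a word for `π` with the minimal number of letters. -/
def IsReducedWord {n : ℕ} (π : Equiv.Perm (Fin n)) (w : List ℕ) : Prop :=
  IsWord π w ∧ ∀ v : List ℕ, IsWord π v → w.length ≤ v.length

/-- The length `ℓ(π)`: the minimal number of letters of a word for `π`. -/
noncomputable def len {n : ℕ} (π : Equiv.Perm (Fin n)) : ℕ :=
  sInf {k : ℕ | ∃ w : List ℕ, IsWord π w ∧ w.length = k}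

/-- The set `R(π)` of reduced words of `π`. -/
def R {n : ℕ} (π : Equiv.Perm (Fin n)) : Set (List ℕ) :=
  {w | IsReducedWord π w}

/-! ### The graphs -/

/-- A commutation move: adjacent letters `j k` with `|j - k| > 1` are switched. -/
def CommMove (w v : List ℕ) : Prop :=
  ∃ (p q : List ℕ) (j k : ℕ), (j + 1 < k ∨ k + 1 < j) ∧
    w = p ++ [j, k] ++ q ∧ v = p ++ [k, j] ++ q

/-- A long braid move, from `j (j+1) j` to `(j+1) j (j+1)` on consecutive indices; the graph
below also uses it in the other direction. -/
def BraidMove (w v : List ℕ) : Prop :=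
  ∃ (p q : List ℕ) (j : ℕ),
    w = p ++ [j, j + 1, j] ++ q ∧ v = p ++ [j + 1, j, j + 1] ++ q

/-- The commutation edges on `R(π)`. -/
def commGraph {n : ℕ} (π : Equiv.Perm (Fin n)) : SimpleGraph (R π) :=
  SimpleGraph.fromRel fun w v => CommMove w.1 v.1

/-- The long braid edges on `R(π)`. -/
def braidGraph {n : ℕ} (π : Equiv.Perm (Fin n)) : SimpleGraph (R π) :=
  SimpleGraph.fromRel fun w v => BraidMove w.1 v.1

/-- The graph `G_π` on `R(π)`, whose edges are the commutation edges and the long braid edges. -/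
def G {n : ℕ} (π : Equiv.Perm (Fin n)) : SimpleGraph (R π) :=
  commGraph π ⊔ braidGraph π

/-- The graph `Γ` contracted along the edges of `H`: its vertices are the connected components
of `H`; two distinct ones are adjacent when `Γ` has an edge between them. -/
def contract {V : Type*} (Γ H : SimpleGraph V) : SimpleGraph H.ConnectedComponent where
  Adj c d := c ≠ d ∧ ∃ u v : V,
    H.connectedComponentMk u = c ∧ H.connectedComponentMk v = d ∧ Γ.Adj u v
  symm := ⟨fun _ _ ⟨h, u, v, hu, hv, huv⟩ => ⟨h.symm, v, u, hv, hu, huv.symm⟩⟩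
  loopless := ⟨fun _ h => h.1 rfl⟩

/-- `C_π`: the graph `G_π` contracted along the commutation edges. -/
def C {n : ℕ} (π : Equiv.Perm (Fin n)) : SimpleGraph (commGraph π).ConnectedComponent :=
  contract (G π) (commGraph π)

/-- `B_π`: the graph `G_π` contracted along the long braid edges. -/
def B {n : ℕ} (π : Equiv.Perm (Fin n)) : SimpleGraph (braidGraph π).ConnectedComponent :=
  contract (G π) (braidGraph π)

/-- `G_π`, `C_π` and `B_π` are connected, so that their diameters are the maximal distances. -/
def GraphsConnected {n : ℕ} (π : Equiv.Perm (Fin n)) : Prop :=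
  (G π).Connected ∧ (C π).Connected ∧ (B π).Connected

end WordGraph

/-! All three diameters come from one structure on the reduced words, a `Grading`: two statistics
`t` and `c` such that a long braid move changes only `t`, a commutation move changes only `c`, each
by at most one, and every word `v` reaches a fixed word `bot` by `t v` braid and `c v` commutation
moves, and a fixed word `top` by the complementary `T - t v` and `D - c v` moves. The lower bounds
on the diameters follow from the Lipschitz functions `t + c`, `t` and `c`, which separate `bot` and
`top` by `T + D`, `T` and `D`. For the upper bounds, the path between two given words through `bot`
and the one through `top` together use exactly `2 * T` braid moves and `2 * D` commutation moves, so
for each count one of the two is short enough. Hence the diameters of `G`, `C` and `B` are `T + D`,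
`T` and `D`.

Gradings are built along the decomposition `12[21[π', 1], π'']`, which exists because an entry
before the least value and an entry after it must be in increasing order when `312` is avoided. For
a direct sum (`Grading.sum`), the reduced words are the shuffles of a reduced word of the first
summand with a shifted one of the second. Letters from different summands commute, so the new
statistic is the number of inversions of the shuffle; it adds the product of the lengths to `D`. For
a skew sum with a point (`Grading.skewPoint`), the strand of the least value crosses each of the
other `k` strands once, always moving to the right. Erasing it leaves a reduced word of `α`.
Carrying one remaining letter across the whole strand takes one braid move and `k - 2` commutations
(`path_cross`), so `T` grows by `len α` and `D` by `(k - 2) * len α`.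

Both descriptions of reduced words rest on a length count: erasing strands gives words of the
smaller permutations, and minimality of length forces equality in the resulting bound. -/

namespace WordGraph

/-! ### Paths of moves -/

/-- `Path w v t c`: the word `v` is obtained from `w` by `t` long braid moves and `c` commutation
moves. -/
inductive Path : List ℕ → List ℕ → ℕ → ℕ → Prop
  | refl (w : List ℕ) : Path w w 0 0
  | comm {w v u : List ℕ} {t c : ℕ} : CommMove w v → Path v u t c → Path w u t (c + 1)
  | braid {w v u : List ℕ} {t c : ℕ} :
      BraidMove w v ∨ BraidMove v w → Path v u t c → Path w u (t + 1) c

theorem CommMove.symm {w v : List ℕ} (h : CommMove w v) : CommMove v w := by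
  obtain ⟨p, q, j, k, hjk, rfl, rfl⟩ := h
  exact ⟨p, q, k, j, hjk.symm, rfl, rfl⟩

theorem CommMove.append_left {w v : List ℕ} (l : List ℕ) (h : CommMove w v) :
    CommMove (l ++ w) (l ++ v) := by
  obtain ⟨p, q, j, k, hjk, rfl, rfl⟩ := h
  exact ⟨l ++ p, q, j, k, hjk, by simp, by simp⟩

theorem CommMove.append_right {w v : List ℕ} (l : List ℕ) (h : CommMove w v) :
    CommMove (w ++ l) (v ++ l) := by
  obtain ⟨p, q, j, k, hjk, rfl, rfl⟩ := h
  exact ⟨p, q ++ l, j, k, hjk, by simp, by simp⟩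

theorem BraidMove.append_left {w v : List ℕ} (l : List ℕ) (h : BraidMove w v) :
    BraidMove (l ++ w) (l ++ v) := by
  obtain ⟨p, q, j, rfl, rfl⟩ := h
  exact ⟨l ++ p, q, j, by simp, by simp⟩

theorem BraidMove.append_right {w v : List ℕ} (l : List ℕ) (h : BraidMove w v) :
    BraidMove (w ++ l) (v ++ l) := by
  obtain ⟨p, q, j, rfl, rfl⟩ := h
  exact ⟨p, q ++ l, j, by simp, by simp⟩

/-- The word with all letters raised by `d`. -/
def shift (d : ℕ) (w : List ℕ) : List ℕ := w.map (· + d)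

theorem CommMove.shift {w v : List ℕ} (d : ℕ) (h : CommMove w v) :
    CommMove (shift d w) (shift d v) := by
  obtain ⟨p, q, j, k, hjk, rfl, rfl⟩ := h
  exact ⟨WordGraph.shift d p, WordGraph.shift d q, j + d, k + d, by omega,
    by simp [WordGraph.shift], by simp [WordGraph.shift]⟩

theorem BraidMove.shift {w v : List ℕ} (d : ℕ) (h : BraidMove w v) :
    BraidMove (shift d w) (shift d v) := by
  obtain ⟨p, q, j, rfl, rfl⟩ := h
  exact ⟨WordGraph.shift d p, WordGraph.shift d q, j + d,
    by simp [WordGraph.shift, add_right_comm], by simp [WordGraph.shift, add_right_comm]⟩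

namespace Path

theorem cast {w v : List ℕ} {t c t' c' : ℕ} (h : Path w v t c) (ht : t = t') (hc : c = c') :
    Path w v t' c' := by
  subst ht hc; exact h

theorem trans {w v u : List ℕ} {t c t' c' : ℕ} (h : Path w v t c) (h' : Path v u t' c') :
    Path w u (t + t') (c + c') := by
  induction h with
  | refl => simpa using h'
  | comm h _ ih => exact (Path.comm h (ih h')).cast rfl (by omega)
  | braid h _ ih => exact (Path.braid h (ih h')).cast (by omega) rfl

theorem symm {w v : List ℕ} {t c : ℕ} (h : Path w v t c) : Path v w t c := by
  induction h with
  | refl => exact refl _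
  | comm h _ ih => exact (ih.trans (Path.comm h.symm (refl _))).cast rfl rfl
  | braid h _ ih => exact (ih.trans (Path.braid h.symm (refl _))).cast rfl rfl

theorem append_left {w v : List ℕ} {t c : ℕ} (l : List ℕ) (h : Path w v t c) :
    Path (l ++ w) (l ++ v) t c := by
  induction h with
  | refl => exact refl _
  | comm h _ ih => exact .comm (h.append_left l) ih
  | braid h _ ih => exact .braid (h.imp (·.append_left l) (·.append_left l)) ih

theorem append_right {w v : List ℕ} {t c : ℕ} (l : List ℕ) (h : Path w v t c) :
    Path (w ++ l) (v ++ l) t c := by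
  induction h with
  | refl => exact refl _
  | comm h _ ih => exact .comm (h.append_right l) ih
  | braid h _ ih => exact .braid (h.imp (·.append_right l) (·.append_right l)) ih

theorem cons {w v : List ℕ} {t c : ℕ} (x : ℕ) (h : Path w v t c) :
    Path (x :: w) (x :: v) t c :=
  h.append_left [x]

theorem shift {w v : List ℕ} {t c : ℕ} (d : ℕ) (h : Path w v t c) :
    Path (shift d w) (shift d v) t c := by
  induction h with
  | refl => exact refl _
  | comm h _ ih => exact .comm (h.shift d) ih
  | braid h _ ih => exact .braid (h.imp (·.shift d) (·.shift d)) ih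

/-- A letter moves past a word whose letters all commute with it. -/
theorem cons_comm (x : ℕ) (l : List ℕ) (h : ∀ y ∈ l, x + 1 < y ∨ y + 1 < x) :
    Path (x :: l) (l ++ [x]) 0 l.length := by
  induction l with
  | nil => exact refl _
  | cons y l ih =>
    refine .comm (v := y :: x :: l) ⟨[], l, x, y, h y (by simp), rfl, rfl⟩ ?_
    exact (ih fun z hz => h z (by simp [hz])).cons y

end Path

/-! ### Words as products in the permutations of `ℕ` -/

/-- The transposition of `x - 1` and `x`. -/
def natSimple (x : ℕ) : Equiv.Perm ℕ := Equiv.swap (x - 1) x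

/-- The permutation of `ℕ` represented by a word. -/
def natProd (w : List ℕ) : Equiv.Perm ℕ := (w.map natSimple).prod

@[simp] theorem natProd_nil : natProd [] = 1 := rfl

@[simp] theorem natProd_cons (x : ℕ) (w : List ℕ) :
    natProd (x :: w) = natSimple x * natProd w := by
  simp [natProd]

@[simp] theorem natProd_append (v w : List ℕ) : natProd (v ++ w) = natProd v * natProd w := by
  simp [natProd]

theorem natSimple_apply (x y : ℕ) :
    natSimple x y = if y = x - 1 then x else if y = x then x - 1 else y :=
  Equiv.swap_apply_def _ _ _

theorem natSimple_val {n x : ℕ} (hx : 1 ≤ x ∧ x < n) (j : Fin n) :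
    natSimple x j = (simple n x j : ℕ) := by
  rw [natSimple_apply, simple, dif_pos hx, Equiv.swap_apply_def]
  simp only [Fin.ext_iff]
  split_ifs <;> rfl

theorem natProd_val {n : ℕ} (w : List ℕ) (hw : ∀ x ∈ w, 1 ≤ x ∧ x < n) (j : Fin n) :
    natProd w j = ((w.map (simple n)).prod j : ℕ) := by
  induction w with
  | nil => rfl
  | cons x w ih =>
    simp only [natProd_cons, Equiv.Perm.mul_apply, List.map_cons, List.prod_cons]
    rw [ih fun y hy => hw y (by simp [hy]), natSimple_val (hw x (by simp))]

/-- Working in `Equiv.Perm ℕ` lets words be shifted, restricted or stripped of a strand without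
changing the ambient symmetric group. -/
theorem isWord_iff {n : ℕ} {π : Equiv.Perm (Fin n)} {w : List ℕ} :
    IsWord π w ↔ (∀ x ∈ w, 1 ≤ x ∧ x < n) ∧ ∀ j : Fin n, natProd w j = (π j : ℕ) := by
  refine and_congr_right fun hw => ?_
  constructor
  · rintro h j
    rw [natProd_val w hw, h]
  · intro h
    ext j
    rw [← natProd_val w hw, h]

theorem CommMove.natProd_eq {w v : List ℕ} (h : CommMove w v) (hw : ∀ x ∈ w, 1 ≤ x) :
    natProd w = natProd v := by
  obtain ⟨p, q, j, k, hjk, rfl, rfl⟩ := h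
  have hj := hw j (by simp)
  have hk := hw k (by simp)
  have : natSimple j * natSimple k = natSimple k * natSimple j := by
    ext y
    simp only [Equiv.Perm.mul_apply, natSimple_apply]
    split_ifs <;> omega
  simp only [natProd_append, natProd_cons, natProd_nil, mul_one, this]

theorem BraidMove.natProd_eq {w v : List ℕ} (h : BraidMove w v) (hw : ∀ x ∈ w, 1 ≤ x) :
    natProd w = natProd v := by
  obtain ⟨p, q, j, rfl, rfl⟩ := h
  have hj := hw j (by simp)
  have : natSimple j * (natSimple (j + 1) * natSimple j) =
      natSimple (j + 1) * (natSimple j * natSimple (j + 1)) := by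
    ext y
    obtain ⟨i, rfl⟩ : ∃ i, j = i + 1 := ⟨j - 1, by omega⟩
    simp only [Equiv.Perm.mul_apply, natSimple_apply, Nat.add_sub_cancel]
    have e₁ : i ≠ i + 1 + 1 := by omega
    have e₂ : i + 1 + 1 ≠ i := by omega
    by_cases h0 : y = i
    · simp [h0, e₁, e₂]
    by_cases h1 : y = i + 1
    · simp [h1, e₁, e₂]
    by_cases h2 : y = i + 2
    · simp [h2, e₁]
    · simp [h0, h1, h2]
  simp only [natProd_append, natProd_cons, natProd_nil, mul_one, this]

theorem CommMove.isWord {n : ℕ} {π : Equiv.Perm (Fin n)} {w v : List ℕ} (h : CommMove w v)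
    (hw : IsWord π w) : IsWord π v := by
  rw [isWord_iff] at hw ⊢
  rw [← h.natProd_eq fun x hx => (hw.1 x hx).1]
  refine ⟨fun x hx => hw.1 x ?_, hw.2⟩
  obtain ⟨p, q, j, k, hjk, rfl, rfl⟩ := h
  simp only [List.mem_append, List.mem_cons] at hx ⊢
  tauto

theorem BraidMove.mem_iff {w v : List ℕ} (h : BraidMove w v) (x : ℕ) : x ∈ w ↔ x ∈ v := by
  obtain ⟨p, q, j, rfl, rfl⟩ := h
  simp only [List.mem_append, List.mem_cons]
  tauto

theorem BraidMove.isWord_iff {n : ℕ} {π : Equiv.Perm (Fin n)} {w v : List ℕ}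
    (h : BraidMove w v) : IsWord π w ↔ IsWord π v := by
  rw [WordGraph.isWord_iff, WordGraph.isWord_iff]
  have hl : (∀ x ∈ w, 1 ≤ x ∧ x < n) ↔ ∀ x ∈ v, 1 ≤ x ∧ x < n := by simp only [h.mem_iff]
  rw [hl]
  refine and_congr_right fun hv => ?_
  rw [h.natProd_eq fun x hx => (hl.2 hv x hx).1]

theorem CommMove.length_eq {w v : List ℕ} (h : CommMove w v) : w.length = v.length := by
  obtain ⟨p, q, j, k, hjk, rfl, rfl⟩ := h
  simp

theorem BraidMove.length_eq {w v : List ℕ} (h : BraidMove w v) : w.length = v.length := by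
  obtain ⟨p, q, j, rfl, rfl⟩ := h
  simp

theorem CommMove.mem_R {n : ℕ} {π : Equiv.Perm (Fin n)} {w v : List ℕ} (h : CommMove w v)
    (hw : w ∈ R π) : v ∈ R π :=
  ⟨h.isWord hw.1, fun u hu => h.length_eq ▸ hw.2 u hu⟩

theorem BraidMove.mem_R_iff {n : ℕ} {π : Equiv.Perm (Fin n)} {w v : List ℕ}
    (h : BraidMove w v) : w ∈ R π ↔ v ∈ R π := by
  change IsReducedWord π w ↔ IsReducedWord π v
  simp only [IsReducedWord, h.isWord_iff, h.length_eq]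

theorem length_eq_len {n : ℕ} {π : Equiv.Perm (Fin n)} {w : List ℕ} (hw : w ∈ R π) :
    w.length = len π := by
  apply le_antisymm
  · exact le_csInf ⟨_, w, hw.1, rfl⟩ fun k ⟨v, hv, hk⟩ => hk ▸ hw.2 v hv
  · exact Nat.sInf_le ⟨w, hw.1, rfl⟩

theorem len_le_length {n : ℕ} {π : Equiv.Perm (Fin n)} {w : List ℕ} (hw : IsWord π w) :
    len π ≤ w.length :=
  Nat.sInf_le ⟨w, hw, rfl⟩

theorem mem_R_of_length_le {n : ℕ} {π : Equiv.Perm (Fin n)} {w : List ℕ} (hw : IsWord π w)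
    (h : w.length ≤ len π) : w ∈ R π :=
  ⟨hw, fun _ hv => h.trans (len_le_length hv)⟩

theorem Path.mem_R {n : ℕ} {π : Equiv.Perm (Fin n)} {w v : List ℕ} {t c : ℕ}
    (h : Path w v t c) (hw : w ∈ R π) : v ∈ R π := by
  induction h with
  | refl => exact hw
  | comm h _ ih => exact ih (h.mem_R hw)
  | braid h _ ih => exact ih (h.elim (fun h => h.mem_R_iff.1 hw) fun h => h.mem_R_iff.2 hw)

/-! ### Gradings -/

/-- A grading of the reduced words of `π`: commutation moves change `c` by at most one and preserve
`t`, long braid moves change `t` by at most one and preserve `c`, and every word is joined to a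
least one (with `t = c = 0`) and a greatest one (with `t = T`, `c = D`) by monotone paths. -/
structure Grading {n : ℕ} (π : Equiv.Perm (Fin n)) (T D : ℕ) where
  /-- the statistic changed by long braid moves -/
  t : List ℕ → ℕ
  /-- the statistic changed by commutation moves -/
  c : List ℕ → ℕ
  /-- the least word -/
  bot : List ℕ
  /-- the greatest word -/
  top : List ℕ
  bot_mem : bot ∈ R π
  top_mem : top ∈ R π
  path_bot : ∀ v ∈ R π, Path v bot (t v) (c v)
  path_top : ∀ v ∈ R π, ∃ t' c', t v + t' = T ∧ c v + c' = D ∧ Path v top t' c'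
  -- Commutation moves are symmetric, so one inequality suffices; `BraidMove` is oriented, so the
  -- next field bounds both directions.
  comm : ∀ w ∈ R π, ∀ v ∈ R π, CommMove w v → t v = t w ∧ c v ≤ c w + 1
  braid : ∀ w ∈ R π, ∀ v ∈ R π, BraidMove w v → c v = c w ∧ t v ≤ t w + 1 ∧ t w ≤ t v + 1
  t_bot : t bot = 0
  c_bot : c bot = 0
  t_top : t top = T
  c_top : c top = D

end WordGraph

namespace WordGraph

/-! ### Diameters of graphs with a grading -/

/-- A function that changes by at most one along edges bounds every walk from `a` to `b` below by
`N`, which matches the upper bound from the given walks. -/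
theorem connected_and_diam_eq {V : Type*} (Γ : SimpleGraph V) (f : V → ℕ) (N : ℕ) (a b : V)
    (hf : ∀ u v, Γ.Adj u v → f v ≤ f u + 1) (ha : f a = 0) (hb : f b = N)
    (h : ∀ u v, ∃ p : Γ.Walk u v, p.length ≤ N) : Γ.Connected ∧ Γ.diam = N := by
  have hwalk : ∀ {u v : V} (p : Γ.Walk u v), f v ≤ f u + p.length := by
    intro u v p
    induction p with
    | nil => simp
    | cons huv p ih =>
      have := hf _ _ huv
      simp only [SimpleGraph.Walk.length_cons]
      omega
  have : Nonempty V := ⟨a⟩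
  have hc : Γ.Connected := ⟨fun u v => ⟨(h u v).choose⟩⟩
  refine ⟨hc, ?_⟩
  have hle : Γ.ediam ≤ N := by
    rw [SimpleGraph.ediam_le_iff]
    intro u v
    obtain ⟨p, hp⟩ := h u v
    exact p.edist_le.trans (by exact_mod_cast hp)
  have hge : (N : ℕ∞) ≤ Γ.ediam := by
    refine le_trans ?_ (SimpleGraph.edist_le_ediam (u := a) (v := b))
    refine le_iInf fun p => ?_
    have := hwalk p
    rw [ha, hb] at this
    exact_mod_cast (by omega : N ≤ p.length)
  rw [SimpleGraph.diam, le_antisymm hle hge]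
  rfl

variable {n : ℕ} {π : Equiv.Perm (Fin n)}

theorem commGraph_adj {w v : R π} : (commGraph π).Adj w v ↔ w ≠ v ∧ CommMove w.1 v.1 := by
  simp only [commGraph, SimpleGraph.fromRel_adj]
  exact and_congr_right fun _ => ⟨fun h => h.elim id CommMove.symm, Or.inl⟩

theorem braidGraph_adj {w v : R π} :
    (braidGraph π).Adj w v ↔ w ≠ v ∧ (BraidMove w.1 v.1 ∨ BraidMove v.1 w.1) := by
  simp [braidGraph, SimpleGraph.fromRel_adj]

theorem G_adj {w v : R π} :
    (G π).Adj w v ↔ (commGraph π).Adj w v ∨ (braidGraph π).Adj w v :=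
  Iff.rfl

theorem Path.exists_walk_G {w v : List ℕ} {t c : ℕ} (h : Path w v t c) (hw : w ∈ R π)
    (hv : v ∈ R π) : ∃ p : (G π).Walk ⟨w, hw⟩ ⟨v, hv⟩, p.length ≤ t + c := by
  induction h with
  | refl => exact ⟨.nil, by simp⟩
  | @comm w v u t c h _ ih =>
    obtain ⟨p, hp⟩ := ih (h.mem_R hw) hv
    by_cases e : w = v
    · subst e; exact ⟨p, by omega⟩
    · refine ⟨.cons (G_adj.2 (Or.inl (commGraph_adj.2 ⟨by simpa using e, h⟩))) p, ?_⟩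
      simp only [SimpleGraph.Walk.length_cons]; omega
  | @braid w v u t c h _ ih =>
    obtain ⟨p, hp⟩ := ih (h.elim (·.mem_R_iff.1 hw) (·.mem_R_iff.2 hw)) hv
    by_cases e : w = v
    · subst e; exact ⟨p, by omega⟩
    · refine ⟨.cons (G_adj.2 (Or.inr (braidGraph_adj.2 ⟨by simpa using e, h⟩))) p, ?_⟩
      simp only [SimpleGraph.Walk.length_cons]; omega

/-- Commutation moves stay inside one contracted vertex, so only the braid moves of the path count.
-/
theorem Path.exists_walk_C {w v : List ℕ} {t c : ℕ} (h : Path w v t c) (hw : w ∈ R π)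
    (hv : v ∈ R π) : ∃ p : (C π).Walk ((commGraph π).connectedComponentMk ⟨w, hw⟩)
      ((commGraph π).connectedComponentMk ⟨v, hv⟩), p.length ≤ t := by
  induction h with
  | refl => exact ⟨.nil, by simp⟩
  | @comm w v u t c h _ ih =>
    have hv' := h.mem_R hw
    obtain ⟨p, hp⟩ := ih hv' hv
    have e : (commGraph π).connectedComponentMk ⟨w, hw⟩ =
        (commGraph π).connectedComponentMk ⟨v, hv'⟩ := by
      by_cases e : w = v
      · subst e; rfl
      · exact SimpleGraph.ConnectedComponent.connectedComponentMk_eq_of_adj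
          (commGraph_adj.2 ⟨by simpa using e, h⟩)
    rw [e]
    exact ⟨p, hp⟩
  | @braid w v u t c h _ ih =>
    have hv' : v ∈ R π := h.elim (·.mem_R_iff.1 hw) (·.mem_R_iff.2 hw)
    obtain ⟨p, hp⟩ := ih hv' hv
    -- A contracted graph has no loops: a braid move whose ends lie in one component contributes no
    -- step.
    by_cases e : (commGraph π).connectedComponentMk ⟨w, hw⟩ =
        (commGraph π).connectedComponentMk ⟨v, hv'⟩
    · rw [e]; exact ⟨p, by omega⟩
    · have hadj : (C π).Adj ((commGraph π).connectedComponentMk ⟨w, hw⟩)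
          ((commGraph π).connectedComponentMk ⟨v, hv'⟩) :=
        ⟨e, _, _, rfl, rfl, G_adj.2 (Or.inr (braidGraph_adj.2 ⟨fun e' => e (congrArg _ e'), h⟩))⟩
      refine ⟨.cons hadj p, ?_⟩
      simp only [SimpleGraph.Walk.length_cons]; omega

theorem Path.exists_walk_B {w v : List ℕ} {t c : ℕ} (h : Path w v t c) (hw : w ∈ R π)
    (hv : v ∈ R π) : ∃ p : (B π).Walk ((braidGraph π).connectedComponentMk ⟨w, hw⟩)
      ((braidGraph π).connectedComponentMk ⟨v, hv⟩), p.length ≤ c := by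
  induction h with
  | refl => exact ⟨.nil, by simp⟩
  | @braid w v u t c h _ ih =>
    have hv' : v ∈ R π := h.elim (·.mem_R_iff.1 hw) (·.mem_R_iff.2 hw)
    obtain ⟨p, hp⟩ := ih hv' hv
    have e : (braidGraph π).connectedComponentMk ⟨w, hw⟩ =
        (braidGraph π).connectedComponentMk ⟨v, hv'⟩ := by
      by_cases e : w = v
      · subst e; rfl
      · exact SimpleGraph.ConnectedComponent.connectedComponentMk_eq_of_adj
          (braidGraph_adj.2 ⟨by simpa using e, h⟩)
    rw [e]
    exact ⟨p, hp⟩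
  | @comm w v u t c h _ ih =>
    have hv' := h.mem_R hw
    obtain ⟨p, hp⟩ := ih hv' hv
    by_cases e : (braidGraph π).connectedComponentMk ⟨w, hw⟩ =
        (braidGraph π).connectedComponentMk ⟨v, hv'⟩
    · rw [e]; exact ⟨p, by omega⟩
    · have hadj : (B π).Adj ((braidGraph π).connectedComponentMk ⟨w, hw⟩)
          ((braidGraph π).connectedComponentMk ⟨v, hv'⟩) :=
        ⟨e, _, _, rfl, rfl, G_adj.2 (Or.inl (commGraph_adj.2 ⟨fun e' => e (congrArg _ e'), h⟩))⟩
      refine ⟨.cons hadj p, ?_⟩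
      simp only [SimpleGraph.Walk.length_cons]; omega

namespace Grading

variable {T D : ℕ}

theorem comm_adj (g : Grading π T D) {w v : R π} (h : (commGraph π).Adj w v) :
    g.t v = g.t w ∧ g.c v ≤ g.c w + 1 :=
  g.comm w w.2 v v.2 (commGraph_adj.1 h).2

theorem braid_adj (g : Grading π T D) {w v : R π} (h : (braidGraph π).Adj w v) :
    g.c v = g.c w ∧ g.t v ≤ g.t w + 1 := by
  rcases (braidGraph_adj.1 h).2 with h | h
  · have := g.braid w w.2 v v.2 h; omega
  · have := g.braid v v.2 w w.2 h; omega

/-- Two words are joined through the least or through the greatest word. -/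
theorem exists_path (g : Grading π T D) {w v : List ℕ} (hw : w ∈ R π) (hv : v ∈ R π) :
    ∃ t₁ c₁ t₂ c₂, Path w v t₁ c₁ ∧ Path w v t₂ c₂ ∧ t₁ + t₂ = 2 * T ∧ c₁ + c₂ = 2 * D := by
  obtain ⟨t, c, ht, hc, h⟩ := g.path_top w hw
  obtain ⟨t', c', ht', hc', h'⟩ := g.path_top v hv
  exact ⟨_, _, _, _, (g.path_bot w hw).trans (g.path_bot v hv).symm, h.trans h'.symm,
    by omega, by omega⟩

theorem G_connected_and_diam (g : Grading π T D) : (G π).Connected ∧ (G π).diam = T + D := by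
  refine connected_and_diam_eq (G π) (fun v => g.t v.1 + g.c v.1) _ ⟨_, g.bot_mem⟩ ⟨_, g.top_mem⟩
    ?_ (by simp [g.t_bot, g.c_bot]) (by simp [g.t_top, g.c_top]) ?_
  · rintro u v (h | h)
    · have := g.comm_adj h; omega
    · have := g.braid_adj h; omega
  · rintro ⟨u, hu⟩ ⟨v, hv⟩
    obtain ⟨t₁, c₁, t₂, c₂, h₁, h₂, ht, hc⟩ := g.exists_path hu hv
    obtain ⟨p, hp⟩ := h₁.exists_walk_G hu hv
    obtain ⟨q, hq⟩ := h₂.exists_walk_G hu hv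
    -- The two lengths add up to `2 * (T + D)`, so they cannot both exceed `T + D`.
    by_cases hl : t₁ + c₁ ≤ T + D
    · exact ⟨p, by omega⟩
    · exact ⟨q, by omega⟩

theorem C_connected_and_diam (g : Grading π T D) : (C π).Connected ∧ (C π).diam = T := by
  -- Constancy of `t` along commutation edges lets it descend to the components.
  have hreach : ∀ u v : R π, (commGraph π).Walk u v → g.t u = g.t v := by
    intro u v p
    induction p with
    | nil => rfl
    | cons h _ ih => rw [← ih, (g.comm_adj h).1]
  let f : (commGraph π).ConnectedComponent → ℕ :=
    SimpleGraph.ConnectedComponent.lift (fun v => g.t v.1) fun u v p _ => hreach u v p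
  refine connected_and_diam_eq (C π) f _ ((commGraph π).connectedComponentMk ⟨_, g.bot_mem⟩)
    ((commGraph π).connectedComponentMk ⟨_, g.top_mem⟩) ?_ g.t_bot g.t_top ?_
  · rintro _ _ ⟨_, u, v, rfl, rfl, h | h⟩
    · have := g.comm_adj h
      change g.t v ≤ g.t u + 1
      omega
    · exact (g.braid_adj h).2
  · intro u v
    induction u using SimpleGraph.ConnectedComponent.ind with | _ u
    induction v using SimpleGraph.ConnectedComponent.ind with | _ v
    obtain ⟨u, hu⟩ := u
    obtain ⟨v, hv⟩ := v
    obtain ⟨t₁, c₁, t₂, c₂, h₁, h₂, ht, hc⟩ := g.exists_path hu hv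
    obtain ⟨p, hp⟩ := h₁.exists_walk_C hu hv
    obtain ⟨q, hq⟩ := h₂.exists_walk_C hu hv
    by_cases hl : t₁ ≤ T
    · exact ⟨p, by omega⟩
    · exact ⟨q, by omega⟩

theorem B_connected_and_diam (g : Grading π T D) : (B π).Connected ∧ (B π).diam = D := by
  have hreach : ∀ u v : R π, (braidGraph π).Walk u v → g.c u = g.c v := by
    intro u v p
    induction p with
    | nil => rfl
    | cons h _ ih => rw [← ih, (g.braid_adj h).1]
  let f : (braidGraph π).ConnectedComponent → ℕ :=
    SimpleGraph.ConnectedComponent.lift (fun v => g.c v.1) fun u v p _ => hreach u v p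
  refine connected_and_diam_eq (B π) f _ ((braidGraph π).connectedComponentMk ⟨_, g.bot_mem⟩)
    ((braidGraph π).connectedComponentMk ⟨_, g.top_mem⟩) ?_ g.c_bot g.c_top ?_
  · rintro _ _ ⟨_, u, v, rfl, rfl, h | h⟩
    · exact (g.comm_adj h).2
    · have := g.braid_adj h
      change g.c v ≤ g.c u + 1
      omega
  · intro u v
    induction u using SimpleGraph.ConnectedComponent.ind with | _ u
    induction v using SimpleGraph.ConnectedComponent.ind with | _ v
    obtain ⟨u, hu⟩ := u
    obtain ⟨v, hv⟩ := v
    obtain ⟨t₁, c₁, t₂, c₂, h₁, h₂, ht, hc⟩ := g.exists_path hu hv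
    obtain ⟨p, hp⟩ := h₁.exists_walk_B hu hv
    obtain ⟨q, hq⟩ := h₂.exists_walk_B hu hv
    by_cases hl : c₁ ≤ D
    · exact ⟨p, by omega⟩
    · exact ⟨q, by omega⟩

theorem graphsConnected (g : Grading π T D) : GraphsConnected π :=
  ⟨g.G_connected_and_diam.1, g.C_connected_and_diam.1, g.B_connected_and_diam.1⟩

end Grading

end WordGraph

namespace WordGraph

/-! ### Restricting a word to the strands of one colour -/

/-- The number of positions before `q` with colour `true`. -/
def cnt (A : ℕ → Bool) (q : ℕ) : ℕ := Nat.count (fun p => A p = true) q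

theorem cnt_succ (A : ℕ → Bool) (q : ℕ) : cnt A (q + 1) = cnt A q + if A q then 1 else 0 :=
  Nat.count_succ _ _

theorem cnt_mono (A : ℕ → Bool) {p q : ℕ} (h : p ≤ q) : cnt A p ≤ cnt A q :=
  Nat.count_monotone _ h

theorem cnt_congr {A A' : ℕ → Bool} {q : ℕ} (h : ∀ p < q, A p = A' p) : cnt A q = cnt A' q := by
  induction q with
  | zero => rfl
  | succ q ih => rw [cnt_succ, cnt_succ, ih fun p hp => h p (by omega), h q (by omega)]

/-- Swapping two adjacent positions affects only the prefix that ends between them. -/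
theorem cnt_comp_natSimple (A : ℕ → Bool) (y q : ℕ) :
    cnt (A ∘ natSimple (y + 1)) q =
      if q = y + 1 then cnt A y + (if A (y + 1) then 1 else 0) else cnt A q := by
  induction q with
  | zero => simp [cnt]
  | succ q ih =>
    rw [cnt_succ, ih, Function.comp_apply, natSimple_apply, Nat.add_sub_cancel]
    by_cases h0 : q = y
    · subst h0; simp
    by_cases h1 : q = y + 1
    · subst h1; simp [cnt_succ]; omega
    · simp [h0, h1, cnt_succ]

/-- The word obtained from `w` by removing the strands whose colour is `false`; `A` is the colour
of the strands by their position before `w`. -/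
def restrict (A : ℕ → Bool) : List ℕ → List ℕ
  | [] => []
  | x :: w =>
    if A (x - 1) && A x then (cnt A (x - 1) + 1) :: restrict (A ∘ natSimple x) w
    else restrict (A ∘ natSimple x) w

/-- The one-letter case of `natProd_restrict`: seen by rank among the `true` strands, a letter acts
as a simple transposition when both strands it exchanges are `true`, and trivially otherwise. -/
theorem cnt_natSimple (A : ℕ → Bool) (y q : ℕ) (hA : A (natSimple (y + 1) q) = true) :
    cnt A (natSimple (y + 1) q) =
      (if A y && A (y + 1) then natSimple (cnt A y + 1) else 1)
        (cnt (A ∘ natSimple (y + 1)) q) := by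
  rw [cnt_comp_natSimple]
  rw [natSimple_apply, Nat.add_sub_cancel] at hA ⊢
  by_cases h0 : q = y
  · subst h0
    simp only [if_true] at hA ⊢
    by_cases hy : A q
    · simp [hy, hA, cnt_succ, natSimple_apply]
    · simp [hy, cnt_succ]
  by_cases h1 : q = y + 1
  · subst h1
    simp only [Nat.succ_ne_self, if_true, if_false] at hA ⊢
    by_cases hy : A (y + 1)
    · simp [hy, hA, natSimple_apply]
    · simp [hy]
  simp only [h0, h1, if_false] at hA ⊢
  by_cases hy : A y && A (y + 1)
  · simp only [hy, if_true, natSimple_apply, Nat.add_sub_cancel]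
    simp only [Bool.and_eq_true] at hy
    rcases Nat.lt_or_ge q y with h | h
    · have := cnt_mono A (show q + 1 ≤ y from h)
      rw [cnt_succ, hA] at this
      simp only [if_true] at this
      rw [if_neg (by omega), if_neg (by omega)]
    · have := cnt_mono A (show y + 1 + 1 ≤ q by omega)
      rw [cnt_succ, cnt_succ, hy.1, hy.2] at this
      simp only [if_true] at this
      rw [if_neg (by omega), if_neg (by omega)]
  · simp [hy]

theorem natProd_restrict (A : ℕ → Bool) (w : List ℕ) (hw : ∀ x ∈ w, 1 ≤ x) (q : ℕ)
    (hA : A (natProd w q) = true) :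
    cnt A (natProd w q) = natProd (restrict A w) (cnt (A ∘ natProd w) q) := by
  induction w generalizing A with
  | nil => rfl
  | cons x w ih =>
    obtain ⟨y, rfl⟩ : ∃ y, x = y + 1 := ⟨x - 1, by have := hw x (by simp); omega⟩
    rw [natProd_cons, Equiv.Perm.mul_apply] at hA ⊢
    rw [cnt_natSimple _ _ _ hA, ih (A ∘ natSimple (y + 1)) (fun z hz => hw z (by simp [hz])) hA]
    simp only [restrict, Nat.add_sub_cancel]
    split_ifs <;> rfl

theorem restrict_bounds (A : ℕ → Bool) (n : ℕ) (w : List ℕ) (hw : ∀ x ∈ w, 1 ≤ x ∧ x < n) :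
    ∀ y ∈ restrict A w, 1 ≤ y ∧ y < cnt A n := by
  induction w generalizing A with
  | nil => simp [restrict]
  | cons x w ih =>
    have hx := hw x (by simp)
    obtain ⟨z, rfl⟩ : ∃ z, x = z + 1 := ⟨x - 1, by omega⟩
    have ih' := ih (A ∘ natSimple (z + 1)) fun y hy => hw y (by simp [hy])
    rw [cnt_comp_natSimple, if_neg (by omega)] at ih'
    intro y hy
    simp only [restrict, Nat.add_sub_cancel] at hy
    split_ifs at hy with h
    · rcases List.mem_cons.1 hy with rfl | hy
      · simp only [Bool.and_eq_true] at h
        have := cnt_mono A (show z + 1 + 1 ≤ n by omega)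
        rw [cnt_succ, cnt_succ, h.1, h.2] at this
        simp only [if_true] at this
        omega
      · exact ih' y hy
    · exact ih' y hy

/-- A letter survives in the restriction to one colour when the two strands it exchanges share that
colour; a letter exchanging different colours is lost from both. -/
theorem length_restrict_add_le (A : ℕ → Bool) (w : List ℕ) :
    (restrict A w).length + (restrict (fun p => !A p) w).length ≤ w.length := by
  induction w generalizing A with
  | nil => simp [restrict]
  | cons x w ih =>
    have := ih (A ∘ natSimple x)
    have e : (fun p => !A p) ∘ natSimple x = fun p => !(A ∘ natSimple x) p := rfl
    simp only [restrict, e]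
    generalize A ∘ natSimple x = B at this ⊢
    cases A (x - 1) <;> cases A x <;> simp <;> omega

/-! ### Words that avoid a letter -/

/-- The letters below `m`. -/
def lo (m : ℕ) (w : List ℕ) : List ℕ := w.filter (· < m)

/-- The letters above `m`, lowered by `m`. -/
def hi (m : ℕ) (w : List ℕ) : List ℕ := (w.filter (m < ·)).map (· - m)

@[simp] theorem lo_append (m : ℕ) (v w : List ℕ) : lo m (v ++ w) = lo m v ++ lo m w := by
  simp [lo]

@[simp] theorem hi_append (m : ℕ) (v w : List ℕ) : hi m (v ++ w) = hi m v ++ hi m w := by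
  simp [hi]

theorem lo_cons_of_lt {m x : ℕ} (w : List ℕ) (h : x < m) : lo m (x :: w) = x :: lo m w := by
  simp [lo, h]

theorem lo_cons_of_gt {m x : ℕ} (w : List ℕ) (h : m < x) : lo m (x :: w) = lo m w := by
  simp [lo, h.le]

theorem hi_cons_of_lt {m x : ℕ} (w : List ℕ) (h : x < m) : hi m (x :: w) = hi m w := by
  simp [hi, h.le]

theorem hi_cons_of_gt {m x : ℕ} (w : List ℕ) (h : m < x) :
    hi m (x :: w) = (x - m) :: hi m w := by
  simp [hi, h]

@[simp] theorem lo_nil (m : ℕ) : lo m [] = [] := rfl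

@[simp] theorem hi_nil (m : ℕ) : hi m [] = [] := rfl

theorem lo_of_lt {m : ℕ} {u : List ℕ} (h : ∀ x ∈ u, x < m) : lo m u = u := by
  simpa [lo] using h

theorem hi_of_lt {m : ℕ} {u : List ℕ} (h : ∀ x ∈ u, x < m) : hi m u = [] := by
  simpa [hi] using fun x hx => (h x hx).le

theorem lo_shift {m : ℕ} (u : List ℕ) : lo m (shift m u) = [] := by
  simp [lo, shift]

theorem hi_shift {m : ℕ} {u : List ℕ} (h : ∀ x ∈ u, 1 ≤ x) : hi m (shift m u) = u := by
  induction u with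
  | nil => rfl
  | cons x u ih =>
    have := h x (by simp)
    have e : shift m (x :: u) = (x + m) :: shift m u := rfl
    rw [e, hi_cons_of_gt _ (by omega), ih fun y hy => h y (by simp [hy]), Nat.add_sub_cancel]

theorem mem_lo {m y : ℕ} {w : List ℕ} : y ∈ lo m w ↔ y ∈ w ∧ y < m := by
  simp [lo]

/-- The number of pairs of a letter above `m` that precedes a letter below `m`. -/
def cross (m : ℕ) : List ℕ → ℕ
  | [] => 0
  | x :: w => if x < m then cross m w else (lo m w).length + cross m w

/-- The letter `m` has to be excluded from `v`: `cross` would treat it as a high letter, while `hi`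
drops it. -/
theorem cross_append (m : ℕ) (v w : List ℕ) (hv : ∀ x ∈ v, x ≠ m) :
    cross m (v ++ w) = cross m v + cross m w + (hi m v).length * (lo m w).length := by
  induction v with
  | nil => simp [cross]
  | cons x v ih =>
    have ih := ih fun y hy => hv y (by simp [hy])
    have hx := hv x (by simp)
    rw [List.cons_append]
    rcases lt_or_gt_of_ne hx with h | h
    · rw [hi_cons_of_lt _ h]
      simp only [cross, h, if_true, ih]
    · rw [hi_cons_of_gt _ h]
      simp only [cross, not_lt.2 h.le, if_false, ih, lo_append, List.length_append,
        List.length_cons]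
      ring

theorem path_lo_hi (m : ℕ) (w : List ℕ) (hw : ∀ x ∈ w, x ≠ m) :
    Path w (lo m w ++ shift m (hi m w)) 0 (cross m w) := by
  induction w with
  | nil => exact .refl _
  | cons x w ih =>
    have ih := ih fun y hy => hw y (by simp [hy])
    rcases lt_or_gt_of_ne (hw x (by simp)) with h | h
    · rw [lo_cons_of_lt _ h, hi_cons_of_lt _ h]
      simp only [cross, h, if_true]
      exact ih.cons x
    · rw [lo_cons_of_gt _ h, hi_cons_of_gt _ h]
      simp only [cross, not_lt.2 h.le, if_false]
      have h2 := (Path.cons_comm x (lo m w) fun y hy => by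
        have := (mem_lo.1 hy).2; omega).append_right (shift m (hi m w))
      have e : shift m ((x - m) :: hi m w) = x :: shift m (hi m w) := by
        simp [shift, h.le]
      rw [e]
      have := ((ih.cons x).trans h2).cast rfl (add_comm _ _)
      simpa using this

/-- Sorting the other way undoes the complementary pairs: each pair of a low and a high letter is
exchanged in exactly one of the two sortings. -/
theorem path_hi_lo (m : ℕ) (w : List ℕ) (hw : ∀ x ∈ w, x ≠ m) :
    ∃ c, cross m w + c = (lo m w).length * (hi m w).length ∧
      Path w (shift m (hi m w) ++ lo m w) 0 c := by
  induction w with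
  | nil => exact ⟨0, rfl, .refl _⟩
  | cons x w ih =>
    obtain ⟨c, hc, ih⟩ := ih fun y hy => hw y (by simp [hy])
    rcases lt_or_gt_of_ne (hw x (by simp)) with h | h
    · rw [lo_cons_of_lt _ h, hi_cons_of_lt _ h]
      simp only [cross, h, if_true]
      have h2 := (Path.cons_comm x (shift m (hi m w)) fun y hy => by
        simp only [shift, hi, List.map_map, List.mem_map, List.mem_filter,
          decide_eq_true_eq, Function.comp_apply] at hy
        omega).append_right (lo m w)
      refine ⟨c + (hi m w).length, ?_, ?_⟩
      · rw [List.length_cons, Nat.succ_mul]; omega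
      · have := (ih.cons x).trans h2
        simpa [shift] using this
    · rw [lo_cons_of_gt _ h, hi_cons_of_gt _ h]
      simp only [cross, not_lt.2 h.le, if_false]
      have e : shift m ((x - m) :: hi m w) = x :: shift m (hi m w) := by
        simp [shift, h.le]
      rw [e]
      exact ⟨c, by rw [List.length_cons, Nat.mul_succ]; omega, ih.cons x⟩

theorem cross_of_lt {m : ℕ} {u : List ℕ} (h : ∀ x ∈ u, x < m) : cross m u = 0 := by
  induction u with
  | nil => rfl
  | cons x u ih => simp [cross, h x (by simp), ih fun y hy => h y (by simp [hy])]

theorem cross_shift {m : ℕ} (u : List ℕ) : cross m (shift m u) = 0 := by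
  induction u with
  | nil => rfl
  | cons x u ih =>
    have e : shift m (x :: u) = (x + m) :: shift m u := rfl
    simp [e, cross, ih, lo_shift]

/-! ### Direct sums -/

/-- `π` is the direct sum of `α` and `β`. -/
structure IsSum {a b n : ℕ} (α : Equiv.Perm (Fin a)) (β : Equiv.Perm (Fin b))
    (π : Equiv.Perm (Fin n)) : Prop where
  size : n = a + b
  left : ∀ (i : Fin a) (j : Fin n), (j : ℕ) = i → (π j : ℕ) = α i
  right : ∀ (i : Fin b) (j : Fin n), (j : ℕ) = a + i → (π j : ℕ) = a + β i

theorem cnt_lt (a q : ℕ) : cnt (fun p => decide (p < a)) q = min q a := by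
  induction q with
  | zero => simp [cnt]
  | succ q ih =>
    rw [cnt_succ, ih]
    by_cases h : q < a
    · simp [h]; omega
    · simp [h]; omega

theorem cnt_not_lt (a q : ℕ) : cnt (fun p => !decide (p < a)) q = q - a := by
  induction q with
  | zero => simp [cnt]
  | succ q ih =>
    rw [cnt_succ, ih]
    by_cases h : q < a
    · simp [h]; omega
    · simp [h]; omega

theorem lt_comp_natSimple {a x : ℕ} (h : x ≠ a) :
    (fun p => decide (p < a)) ∘ natSimple x = fun p => decide (p < a) := by
  funext p
  simp only [Function.comp_apply, natSimple_apply, decide_eq_decide]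
  split_ifs <;> omega

theorem not_lt_comp_natSimple {a x : ℕ} (h : x ≠ a) :
    (fun p => !decide (p < a)) ∘ natSimple x = fun p => !decide (p < a) := by
  funext p
  exact congrArg Bool.not (congrFun (lt_comp_natSimple h) p)

theorem restrict_lt {a : ℕ} (w : List ℕ) (hw : ∀ x ∈ w, 1 ≤ x ∧ x ≠ a) :
    restrict (fun p => decide (p < a)) w = lo a w := by
  induction w with
  | nil => rfl
  | cons x w ih =>
    obtain ⟨h1, hx⟩ := hw x (by simp)
    rw [restrict, lt_comp_natSimple hx, ih fun y hy => hw y (by simp [hy]), cnt_lt]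
    rcases lt_or_gt_of_ne hx with h | h
    · rw [lo_cons_of_lt _ h, if_pos (by simp; omega)]
      congr 1; omega
    · rw [lo_cons_of_gt _ h, if_neg (by simp; omega)]

theorem restrict_not_lt {a : ℕ} (w : List ℕ) (hw : ∀ x ∈ w, 1 ≤ x ∧ x ≠ a) :
    restrict (fun p => !decide (p < a)) w = hi a w := by
  induction w with
  | nil => rfl
  | cons x w ih =>
    obtain ⟨h1, hx⟩ := hw x (by simp)
    rw [restrict, not_lt_comp_natSimple hx, ih fun y hy => hw y (by simp [hy]), cnt_not_lt]
    rcases lt_or_gt_of_ne hx with h | h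
    · rw [hi_cons_of_lt _ h, if_neg (by simp; omega)]
    · rw [hi_cons_of_gt _ h, if_pos (by simp; omega)]
      congr 1; omega

/-- Letters other than `a` leave the colouring by `p < a` unchanged, so a first letter `a` would
exchange two strands of different colours and be lost from both restrictions. -/
theorem not_mem_of_length_restrict {a : ℕ} (w : List ℕ) (hw : ∀ x ∈ w, 1 ≤ x)
    (h : w.length ≤ (restrict (fun p => decide (p < a)) w).length +
      (restrict (fun p => !decide (p < a)) w).length) : ∀ x ∈ w, x ≠ a := by
  induction w with
  | nil => simp
  | cons x w ih =>
    have h1 := hw x (by simp)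
    by_cases hx : x = a
    · exfalso
      subst hx
      have := length_restrict_add_le ((fun p => decide (p < x)) ∘ natSimple x) w
      have e : (fun p => !decide (p < x)) ∘ natSimple x =
        fun p => !((fun p => decide (p < x)) ∘ natSimple x) p := rfl
      rw [restrict, restrict, if_neg (by simp), if_neg (by simp; omega), e] at h
      simp only [List.length_cons] at h
      omega
    · have := ih (fun y hy => hw y (by simp [hy])) (by
        rw [restrict, restrict, lt_comp_natSimple hx, not_lt_comp_natSimple hx] at h
        rcases lt_or_gt_of_ne hx with hl | hl
        · rw [if_neg (by simp; omega : ¬ (!decide (x - 1 < a) && !decide (x < a)) = true)] at h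
          split_ifs at h <;> simp only [List.length_cons] at h <;> omega
        · rw [if_neg (by simp; omega : ¬ (decide (x - 1 < a) && decide (x < a)) = true)] at h
          split_ifs at h <;> simp only [List.length_cons] at h <;> omega)
      intro y hy
      rcases List.mem_cons.1 hy with rfl | hy
      · exact hx
      · exact this y hy

/-! ### Products of low words and of shifted words -/

theorem natProd_of_forall_lt {a : ℕ} (u : List ℕ) (hu : ∀ x ∈ u, x < a) (q : ℕ) (hq : a ≤ q) :
    natProd u q = q := by
  induction u with
  | nil => rfl
  | cons x u ih =>
    rw [natProd_cons, Equiv.Perm.mul_apply, ih fun y hy => hu y (by simp [hy]), natSimple_apply]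
    have := hu x (by simp)
    rw [if_neg (by omega), if_neg (by omega)]

theorem natProd_shift_lt {a : ℕ} (u : List ℕ) (hu : ∀ x ∈ u, 1 ≤ x) (q : ℕ) (hq : q < a) :
    natProd (shift a u) q = q := by
  induction u with
  | nil => rfl
  | cons x u ih =>
    have e : shift a (x :: u) = (x + a) :: shift a u := rfl
    rw [e, natProd_cons, Equiv.Perm.mul_apply, ih fun y hy => hu y (by simp [hy]),
      natSimple_apply]
    have := hu x (by simp)
    rw [if_neg (by omega), if_neg (by omega)]

theorem natProd_shift_add {a : ℕ} (u : List ℕ) (hu : ∀ x ∈ u, 1 ≤ x) (q : ℕ) :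
    natProd (shift a u) (a + q) = a + natProd u q := by
  induction u with
  | nil => rfl
  | cons x u ih =>
    have e : shift a (x :: u) = (x + a) :: shift a u := rfl
    rw [e, natProd_cons, Equiv.Perm.mul_apply, ih fun y hy => hu y (by simp [hy]),
      natProd_cons, Equiv.Perm.mul_apply, natSimple_apply, natSimple_apply]
    have := hu x (by simp)
    split_ifs <;> omega

namespace IsSum

variable {a b n : ℕ} {α : Equiv.Perm (Fin a)} {β : Equiv.Perm (Fin b)} {π : Equiv.Perm (Fin n)}

theorem isWord_restrict (h : IsSum α β π) {w : List ℕ} (hw : IsWord π w) :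
    IsWord α (restrict (fun p => decide (p < a)) w) ∧
      IsWord β (restrict (fun p => !decide (p < a)) w) := by
  obtain ⟨hl, hw⟩ := isWord_iff.1 hw
  have hn := h.size
  have hleft : ∀ q, ∀ hq : q < a, natProd w q = α ⟨q, hq⟩ := fun q hq => by
    rw [← h.left ⟨q, hq⟩ ⟨q, by omega⟩ rfl, ← hw]
  have hright : ∀ q, ∀ hq : q < b, natProd w (a + q) = a + β ⟨q, hq⟩ := fun q hq => by
    rw [← h.right ⟨q, hq⟩ ⟨a + q, by omega⟩ rfl, ← hw]
  -- A direct sum preserves both blocks, so the colouring after the word is the original one and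
  -- ranks can be read off from `cnt_lt` and `cnt_not_lt`.
  have hcol : ∀ q, q < n → (decide (natProd w q < a) = decide (q < a)) := fun q hq => by
    rw [decide_eq_decide]
    by_cases hqa : q < a
    · rw [hleft q hqa]; simp [hqa]
    · obtain ⟨r, rfl⟩ : ∃ r, q = a + r := ⟨q - a, by omega⟩
      rw [hright r (by omega)]; simp
  constructor
  · refine isWord_iff.2 ⟨fun y hy => ?_, fun j => ?_⟩
    · have := restrict_bounds _ n w hl y hy
      rw [cnt_lt] at this
      omega
    · have := natProd_restrict (fun p => decide (p < a)) w (fun x hx => (hl x hx).1) j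
        (by rw [hleft _ j.2]; simp)
      rw [cnt_lt, cnt_congr (A := (fun p => decide (p < a)) ∘ natProd w)
        (A' := fun p => decide (p < a)) fun p hp => hcol p (by omega),
        cnt_lt, hleft _ j.2] at this
      rw [min_eq_left (Fin.is_lt _).le, min_eq_left (Fin.is_lt _).le] at this
      exact this.symm
  · refine isWord_iff.2 ⟨fun y hy => ?_, fun j => ?_⟩
    · have := restrict_bounds _ n w hl y hy
      rw [cnt_not_lt] at this
      omega
    · have := natProd_restrict (fun p => !decide (p < a)) w (fun x hx => (hl x hx).1) (a + j)
        (by rw [hright _ j.2]; simp)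
      rw [cnt_not_lt, cnt_congr (A := (fun p => !decide (p < a)) ∘ natProd w)
        (A' := fun p => !decide (p < a)) fun p hp =>
          congrArg Bool.not (hcol p (by omega)), cnt_not_lt, hright _ j.2] at this
      simpa using this.symm

theorem isWord_append (h : IsSum α β π) {u w : List ℕ} (hu : IsWord α u) (hw : IsWord β w) :
    IsWord π (u ++ shift a w) := by
  have hn := h.size
  obtain ⟨hul, hu⟩ := isWord_iff.1 hu
  obtain ⟨hwl, hw⟩ := isWord_iff.1 hw
  refine isWord_iff.2 ⟨fun x hx => ?_, fun j => ?_⟩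
  · rcases List.mem_append.1 hx with hx | hx
    · have := hul x hx; omega
    · obtain ⟨y, hy, rfl⟩ := List.mem_map.1 hx
      have := hwl y hy; omega
  · rw [natProd_append, Equiv.Perm.mul_apply]
    by_cases hj : (j : ℕ) < a
    · rw [natProd_shift_lt _ (fun x hx => (hwl x hx).1) _ hj, h.left ⟨j, hj⟩ j rfl, ← hu]
    · have e : (j : ℕ) = a + (j - a) := by omega
      have e' : natProd (shift a w) j = a + natProd w (j - a : ℕ) := by
        rw [← natProd_shift_add _ fun x hx => (hwl x hx).1, ← e]
      rw [h.right ⟨j - a, by omega⟩ j e, e', natProd_of_forall_lt u (fun x hx => (hul x hx).2) _ (by omega), ← hw]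

/-- The concatenation is shortest because the two restrictions of any word for `π` are words for `α`
and `β`, with total length at most that of the word. -/
theorem len_eq (h : IsSum α β π) {u w : List ℕ} (hu : u ∈ R α) (hw : w ∈ R β) :
    u ++ shift a w ∈ R π ∧ len π = len α + len β := by
  have hword := h.isWord_append hu.1 hw.1
  have hlen : (u ++ shift a w).length = len α + len β := by
    rw [← length_eq_len hu, ← length_eq_len hw]; simp [shift]
  have hmem : u ++ shift a w ∈ R π := ⟨hword, fun v hv => by
    have h1 := len_le_length (h.isWord_restrict hv).1
    have h2 := len_le_length (h.isWord_restrict hv).2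
    have := length_restrict_add_le (fun p => decide (p < a)) v
    omega⟩
  exact ⟨hmem, by rw [← length_eq_len hmem, hlen]⟩

/-- For a reduced word the restriction bound is attained: no letter exchanges strands of different
blocks, and both restrictions are themselves shortest. -/
theorem mem_R (h : IsSum α β π) (hlen : len π = len α + len β) {v : List ℕ} (hv : v ∈ R π) :
    (∀ x ∈ v, x ≠ a) ∧ lo a v ∈ R α ∧ hi a v ∈ R β := by
  have hword := h.isWord_restrict hv.1
  have h1 := len_le_length hword.1
  have h2 := len_le_length hword.2
  have h3 := length_restrict_add_le (fun p => decide (p < a)) v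
  have h4 := length_eq_len hv
  have hpos : ∀ x ∈ v, 1 ≤ x := fun x hx => (hv.1.1 x hx).1
  have hne := not_mem_of_length_restrict (a := a) v hpos (by omega)
  have hne' : ∀ x ∈ v, 1 ≤ x ∧ x ≠ a := fun x hx => ⟨hpos x hx, hne x hx⟩
  rw [← restrict_lt v hne', ← restrict_not_lt v hne']
  exact ⟨hne, mem_R_of_length_le hword.1 (by omega), mem_R_of_length_le hword.2 (by omega)⟩

end IsSum

/-- The two letters are both low, both high, or on different sides of `m`; only the last case
changes `cross`. -/
theorem lo_hi_comm {m : ℕ} {w v : List ℕ} (h : CommMove w v) (hw : ∀ x ∈ w, x ≠ m) :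
    (CommMove (lo m w) (lo m v) ∧ hi m v = hi m w ∧ cross m v = cross m w) ∨
    (lo m v = lo m w ∧ CommMove (hi m w) (hi m v) ∧ cross m v = cross m w) ∨
    (lo m v = lo m w ∧ hi m v = hi m w ∧ cross m v ≤ cross m w + 1) := by
  obtain ⟨p, q, j, k, hjk, rfl, rfl⟩ := h
  have hp : ∀ x ∈ p, x ≠ m := fun x hx => hw x (by simp [hx])
  have hj := hw j (by simp)
  have hk := hw k (by simp)
  simp only [List.append_assoc, List.cons_append, List.nil_append, cross_append m p _ hp,
    lo_append, hi_append]
  rcases lt_or_gt_of_ne hj with hj | hj <;> rcases lt_or_gt_of_ne hk with hk | hk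
  · left
    simp only [lo_cons_of_lt _ hj, lo_cons_of_lt _ hk, hi_cons_of_lt _ hj, hi_cons_of_lt _ hk,
      cross, hj, hk, if_true, List.length_cons, and_self, and_true]
    exact ⟨_, _, j, k, hjk, by simp; rfl, by simp⟩
  · right; right
    simp only [lo_cons_of_lt _ hj, lo_cons_of_gt _ hk, hi_cons_of_lt _ hj, hi_cons_of_gt _ hk,
      cross, hj, not_lt.2 hk.le, if_true, if_false, List.length_cons, true_and]
    omega
  · right; right
    simp only [lo_cons_of_gt _ hj, lo_cons_of_lt _ hk, hi_cons_of_gt _ hj, hi_cons_of_lt _ hk,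
      cross, hk, not_lt.2 hj.le, if_true, if_false, List.length_cons, true_and]
    omega
  · right; left
    simp only [lo_cons_of_gt _ hj, lo_cons_of_gt _ hk, hi_cons_of_gt _ hj, hi_cons_of_gt _ hk,
      cross, not_lt.2 hj.le, not_lt.2 hk.le, if_false, and_true, true_and]
    exact ⟨_, _, j - m, k - m, by omega, by simp; rfl, by simp⟩

/-- The letters `j` and `j + 1` both differ from `m`, so they lie on the same side of it and a braid
move cannot mix the two parts. -/
theorem lo_hi_braid {m : ℕ} {w v : List ℕ} (h : BraidMove w v) (hw : ∀ x ∈ w, x ≠ m) :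
    (BraidMove (lo m w) (lo m v) ∧ hi m v = hi m w ∧ cross m v = cross m w) ∨
    (lo m v = lo m w ∧ BraidMove (hi m w) (hi m v) ∧ cross m v = cross m w) := by
  obtain ⟨p, q, j, rfl, rfl⟩ := h
  have hp : ∀ x ∈ p, x ≠ m := fun x hx => hw x (by simp [hx])
  have hj := hw j (by simp)
  have hk := hw (j + 1) (by simp)
  simp only [List.append_assoc, List.cons_append, List.nil_append, cross_append m p _ hp,
    lo_append, hi_append]
  rcases lt_or_gt_of_ne hj with hj | hj
  · left
    have hk : j + 1 < m := by omega
    simp only [lo_cons_of_lt _ hj, lo_cons_of_lt _ hk, hi_cons_of_lt _ hj, hi_cons_of_lt _ hk,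
      cross, hj, hk, if_true, List.length_cons, and_self, and_true]
    exact ⟨_, _, j, by simp; rfl, by simp⟩
  · right
    have hk : m < j + 1 := by omega
    simp only [lo_cons_of_gt _ hj, lo_cons_of_gt _ hk, hi_cons_of_gt _ hj, hi_cons_of_gt _ hk,
      cross, not_lt.2 hj.le, not_lt.2 hk.le, if_false, and_true, true_and,
      show j + 1 - m = j - m + 1 by omega]
    exact ⟨_, _, j - m, by simp; rfl, by simp⟩

/-- The grading of a direct sum. -/
def Grading.sum {a b n : ℕ} {α : Equiv.Perm (Fin a)} {β : Equiv.Perm (Fin b)}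
    {π : Equiv.Perm (Fin n)} {T D T' D' : ℕ} (h : IsSum α β π) (g : Grading α T D)
    (g' : Grading β T' D') : Grading π (T + T') (D + D' + len α * len β) where
  t v := g.t (lo a v) + g'.t (hi a v)
  c v := g.c (lo a v) + g'.c (hi a v) + cross a v
  bot := g.bot ++ shift a g'.bot
  top := shift a g'.top ++ g.top
  bot_mem := (h.len_eq g.bot_mem g'.bot_mem).1
  top_mem := by
    have hlt : ∀ x ∈ g.top, x < a := fun x hx => (g.top_mem.1.1 x hx).2
    have hpos : ∀ x ∈ g'.top, 1 ≤ x := fun x hx => (g'.top_mem.1.1 x hx).1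
    obtain ⟨hmem, hlen⟩ := h.len_eq g.top_mem g'.top_mem
    -- The word with the high letters first is reduced because commutations lead to it from the word
    -- with the low letters first.
    obtain ⟨c, -, hp⟩ := path_hi_lo a (g.top ++ shift a g'.top) (h.mem_R hlen hmem).1
    have := hp.mem_R hmem
    rwa [lo_append, hi_append, lo_of_lt hlt, hi_of_lt hlt, lo_shift, hi_shift hpos,
      List.append_nil, List.nil_append] at this
  path_bot v hv := by
    obtain ⟨-, hlen⟩ := h.len_eq g.top_mem g'.top_mem
    obtain ⟨hne, hl, hh⟩ := h.mem_R hlen hv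
    exact ((path_lo_hi a v hne).trans (((g.path_bot _ hl).append_right _).trans
      (((g'.path_bot _ hh).shift a).append_left _))).cast (by omega) (by omega)
  path_top v hv := by
    obtain ⟨-, hlen⟩ := h.len_eq g.top_mem g'.top_mem
    obtain ⟨hne, hl, hh⟩ := h.mem_R hlen hv
    obtain ⟨c, hc, hp⟩ := path_hi_lo a v hne
    obtain ⟨t₁, c₁, ht₁, hc₁, h₁⟩ := g.path_top _ hl
    obtain ⟨t₂, c₂, ht₂, hc₂, h₂⟩ := g'.path_top _ hh
    rw [length_eq_len hl, length_eq_len hh] at hc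
    exact ⟨_, _, by omega, by omega,
      hp.trans (((h₂.shift a).append_right _).trans (h₁.append_left _))⟩
  comm w hw v hv hwv := by
    obtain ⟨-, hlen⟩ := h.len_eq g.top_mem g'.top_mem
    obtain ⟨hne, hl, hh⟩ := h.mem_R hlen hw
    obtain ⟨-, hl', hh'⟩ := h.mem_R hlen hv
    rcases lo_hi_comm hwv hne with ⟨h1, h2, h3⟩ | ⟨h1, h2, h3⟩ | ⟨h1, h2, h3⟩
    · have := g.comm _ hl _ hl' h1
      rw [h2]; omega
    · have := g'.comm _ hh _ hh' h2
      rw [h1]; omega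
    · rw [h1, h2]; omega
  braid w hw v hv hwv := by
    obtain ⟨-, hlen⟩ := h.len_eq g.top_mem g'.top_mem
    obtain ⟨hne, hl, hh⟩ := h.mem_R hlen hw
    obtain ⟨-, hl', hh'⟩ := h.mem_R hlen hv
    rcases lo_hi_braid hwv hne with ⟨h1, h2, h3⟩ | ⟨h1, h2, h3⟩
    · have := g.braid _ hl _ hl' h1
      rw [h2]; omega
    · have := g'.braid _ hh _ hh' h2
      rw [h1]; omega
  t_bot := by
    have hlt : ∀ x ∈ g.bot, x < a := fun x hx => (g.bot_mem.1.1 x hx).2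
    have hpos : ∀ x ∈ g'.bot, 1 ≤ x := fun x hx => (g'.bot_mem.1.1 x hx).1
    rw [lo_append, hi_append, lo_of_lt hlt, hi_of_lt hlt, lo_shift, hi_shift hpos,
      List.append_nil, List.nil_append, g.t_bot, g'.t_bot]
  c_bot := by
    have hlt : ∀ x ∈ g.bot, x < a := fun x hx => (g.bot_mem.1.1 x hx).2
    have hpos : ∀ x ∈ g'.bot, 1 ≤ x := fun x hx => (g'.bot_mem.1.1 x hx).1
    rw [cross_append _ _ _ fun x hx => (hlt x hx).ne, lo_append, hi_append, lo_of_lt hlt,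
      hi_of_lt hlt, lo_shift, hi_shift hpos,
      List.append_nil, List.nil_append, g.c_bot, g'.c_bot, cross_of_lt hlt, cross_shift]
    simp
  t_top := by
    have hlt : ∀ x ∈ g.top, x < a := fun x hx => (g.top_mem.1.1 x hx).2
    have hpos : ∀ x ∈ g'.top, 1 ≤ x := fun x hx => (g'.top_mem.1.1 x hx).1
    rw [lo_append, hi_append, lo_of_lt hlt, hi_of_lt hlt, lo_shift, hi_shift hpos,
      List.append_nil, List.nil_append, g.t_top, g'.t_top]
  c_top := by
    have hlt : ∀ x ∈ g.top, x < a := fun x hx => (g.top_mem.1.1 x hx).2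
    have hpos : ∀ x ∈ g'.top, 1 ≤ x := fun x hx => (g'.top_mem.1.1 x hx).1
    rw [cross_append _ _ _ fun x hx => ?_, lo_append, hi_append, lo_of_lt hlt,
      hi_of_lt hlt, lo_shift, hi_shift hpos,
      List.append_nil, List.nil_append, g.c_top, g'.c_top, cross_of_lt hlt, cross_shift,
      length_eq_len g.top_mem, length_eq_len g'.top_mem]
    · ring
    · obtain ⟨y, hy, rfl⟩ := List.mem_map.1 hx
      have := hpos y hy
      omega

end WordGraph

namespace WordGraph

/-! ### Removing the strand of the least value -/

/-- The position after the word `w` of the strand that starts at position `i`. -/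
def pos : ℕ → List ℕ → ℕ
  | i, [] => i
  | i, x :: w => if x = i + 1 then pos (i + 1) w else if x = i then pos (i - 1) w else pos i w

/-- The word `w` with the strand that starts at position `i` removed. -/
def dec : ℕ → List ℕ → List ℕ
  | _, [] => []
  | i, x :: w =>
    if x = i + 1 then dec (i + 1) w else if x = i then dec (i - 1) w
    else (if x < i then x else x - 1) :: dec i w

/-- The number of letters of `w` above the strand that starts at position `i`. -/
def strandT : ℕ → List ℕ → ℕ
  | _, [] => 0
  | i, x :: w =>
    if x = i + 1 then strandT (i + 1) w else if x = i then strandT (i - 1) w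
    else (if x < i then 0 else 1) + strandT i w

/-- The number of pairs of a letter of `w` outside the strand and a later commuting letter of the
strand, which starts at position `i` and ends at position `k`. -/
def strandC (k : ℕ) : ℕ → List ℕ → ℕ
  | _, [] => 0
  | i, x :: w =>
    if x = i + 1 then strandC k (i + 1) w else if x = i then strandC k (i - 1) w
    else (if x < i then k - i else k - i - 2) + strandC k i w

/-- The strand of `w` that starts at position `i` never moves to the left and ends at position
`k`, and the letters of `w` are at most `k`. -/
def Rising (k : ℕ) : ℕ → List ℕ → Prop
  | i, [] => i = k
  | i, x :: w =>
    if x = i + 1 then Rising k (i + 1) w else (1 ≤ x ∧ x ≤ k ∧ x ≠ i) ∧ Rising k i w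

theorem Rising.le {k i : ℕ} {w : List ℕ} (h : Rising k i w) : i ≤ k := by
  induction w generalizing i with
  | nil => exact le_of_eq h
  | cons x w ih =>
    simp only [Rising] at h
    split_ifs at h
    · have := ih h; omega
    · exact ih h.2

theorem dec_append (i : ℕ) (p r : List ℕ) : dec i (p ++ r) = dec i p ++ dec (pos i p) r := by
  induction p generalizing i with
  | nil => rfl
  | cons x p ih =>
    simp only [List.cons_append, dec, pos]
    split_ifs <;> simp [ih]

theorem pos_append (i : ℕ) (p r : List ℕ) : pos i (p ++ r) = pos (pos i p) r := by
  induction p generalizing i with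
  | nil => rfl
  | cons x p ih =>
    simp only [List.cons_append, pos]
    split_ifs <;> simp [ih]

theorem strandT_append (i : ℕ) (p r : List ℕ) :
    strandT i (p ++ r) = strandT i p + strandT (pos i p) r := by
  induction p generalizing i with
  | nil => simp [strandT, pos]
  | cons x p ih =>
    simp only [List.cons_append, strandT, pos]
    split_ifs <;> simp [ih, add_assoc]

theorem strandC_append (k i : ℕ) (p r : List ℕ) :
    strandC k i (p ++ r) = strandC k i p + strandC k (pos i p) r := by
  induction p generalizing i with
  | nil => simp [strandC, pos]
  | cons x p ih =>
    simp only [List.cons_append, strandC, pos]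
    split_ifs <;> simp [ih, add_assoc]

theorem Rising.of_append {k i : ℕ} {p r : List ℕ} (h : Rising k i (p ++ r)) :
    Rising k (pos i p) r := by
  induction p generalizing i with
  | nil => exact h
  | cons x p ih =>
    simp only [List.cons_append, Rising, pos] at h ⊢
    split_ifs at h ⊢ with h1 h2
    · exact ih h
    · exact absurd h2 h.1.2.2
    · exact ih h.2

/-- The increasing injection of `ℕ` into `ℕ` that omits `i`. -/
def skip (i y : ℕ) : ℕ := if y < i then y else y + 1

/-- Erasing a strand: `skip` renumbers the other positions before and after the word, and between
these numberings `dec i w` acts as `w` does on the other strands. -/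
theorem natProd_skip (i : ℕ) (w : List ℕ) (hw : ∀ x ∈ w, 1 ≤ x) :
    natProd w (pos i w) = i ∧
      ∀ y, natProd w (skip (pos i w) y) = skip i (natProd (dec i w) y) := by
  induction w generalizing i with
  | nil => exact ⟨rfl, fun _ => rfl⟩
  | cons x w ih =>
    have hx := hw x (by simp)
    have ih := fun i => ih i fun y hy => hw y (by simp [hy])
    simp only [pos, dec, natProd_cons, Equiv.Perm.mul_apply]
    split_ifs with h1 h2 h3
    · refine ⟨?_, fun y => ?_⟩
      · rw [(ih _).1, natSimple_apply]; split_ifs <;> omega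
      · rw [(ih _).2, natSimple_apply]; simp only [skip]; split_ifs <;> omega
    · refine ⟨?_, fun y => ?_⟩
      · rw [(ih _).1, natSimple_apply]; split_ifs <;> omega
      · rw [(ih _).2, natSimple_apply]; simp only [skip]; split_ifs <;> omega
    · refine ⟨?_, fun y => ?_⟩
      · rw [(ih _).1, natSimple_apply]; split_ifs <;> omega
      · rw [(ih _).2, natProd_cons, Equiv.Perm.mul_apply, natSimple_apply, natSimple_apply]
        simp only [skip]; split_ifs <;> omega
    · refine ⟨?_, fun y => ?_⟩
      · rw [(ih _).1, natSimple_apply]; split_ifs <;> omega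
      · rw [(ih _).2, natProd_cons, Equiv.Perm.mul_apply, natSimple_apply, natSimple_apply]
        simp only [skip]; split_ifs <;> omega

theorem dec_bounds {k i : ℕ} (hi : i ≤ k) {w : List ℕ} (hw : ∀ x ∈ w, 1 ≤ x ∧ x ≤ k) :
    ∀ y ∈ dec i w, 1 ≤ y ∧ y < k := by
  induction w generalizing i with
  | nil => simp [dec]
  | cons x w ih =>
    have hx := hw x (by simp)
    have hw' : ∀ y ∈ w, 1 ≤ y ∧ y ≤ k := fun y hy => hw y (by simp [hy])
    simp only [dec]
    split_ifs with h1 h2 h3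
    · exact ih (by omega) hw'
    · exact ih (by omega) hw'
    · intro y hy
      rcases List.mem_cons.1 hy with rfl | hy
      · omega
      · exact ih hi hw' y hy
    · intro y hy
      rcases List.mem_cons.1 hy with rfl | hy
      · omega
      · exact ih hi hw' y hy

/-- Each letter either survives in `dec` or moves the strand by one, so the strand gains at most one
position per lost letter. -/
theorem pos_add_length_dec_le (i : ℕ) (w : List ℕ) :
    pos i w + (dec i w).length ≤ i + w.length := by
  induction w generalizing i with
  | nil => simp [pos, dec]
  | cons x w ih =>
    simp only [pos, dec, List.length_cons]
    split_ifs
    · have := ih (i + 1); omega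
    · have := ih (i - 1); omega
    · have := ih i; simp only [List.length_cons]; omega
    · have := ih i; simp only [List.length_cons]; omega

theorem rising_of_length_le {k i : ℕ} {w : List ℕ} (hw : ∀ x ∈ w, 1 ≤ x ∧ x ≤ k)
    (hpos : pos i w = k) (hlen : i + w.length ≤ k + (dec i w).length) : Rising k i w := by
  induction w generalizing i with
  | nil => exact hpos
  | cons x w ih =>
    have hx := hw x (by simp)
    have hw' : ∀ y ∈ w, 1 ≤ y ∧ y ≤ k := fun y hy => hw y (by simp [hy])
    simp only [Rising]
    simp only [pos, dec, List.length_cons] at hpos hlen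
    split_ifs at hpos hlen ⊢ with h1 h2
    · exact ih hw' hpos (by omega)
    -- A move to the left uses a letter and loses a position, which contradicts the tight length.
    · have := pos_add_length_dec_le (i - 1) w
      omega
    all_goals
      simp only [List.length_cons] at hlen
      exact ⟨⟨hx.1, hx.2, h2⟩, ih hw' hpos (by omega)⟩

/-! ### Crossing a strand -/

/-- The letter `x` commutes past `i + 1, …, x - 2`, becomes `x - 1` through the braid relation with
`x - 1, x`, and then commutes past `x + 1, …, k`. -/
theorem path_cross {i k x : ℕ} (h : i + 1 < x) (hk : x ≤ k) :
    Path (x :: List.range' (i + 1) (k - i)) (List.range' (i + 1) (k - i) ++ [x - 1]) 1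
      (k - i - 2) := by
  -- Here `d` counts the strand letters before the braid and `e` those after it, so `d + e = k - i -
  -- 2`.
  obtain ⟨d, rfl⟩ : ∃ d, x = i + d + 2 := ⟨x - i - 2, by omega⟩
  obtain ⟨e, rfl⟩ : ∃ e, k = i + d + 2 + e := ⟨k - (i + d + 2), by omega⟩
  have hr : List.range' (i + 1) (i + d + 2 + e - i) =
      List.range' (i + 1) d ++ ([i + d + 1, i + d + 2] ++ List.range' (i + d + 3) e) := by
    rw [show i + d + 2 + e - i = d + (2 + e) by omega, ← List.range'_append_1,
      ← List.range'_append_1]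
    congr 2
    · simp [List.range'_succ]; omega
    · congr 1; omega
  rw [hr, show i + d + 2 - 1 = i + d + 1 by omega]
  have p1 := (Path.cons_comm (i + d + 2) (List.range' (i + 1) d) fun y hy => by
    rw [List.mem_range'_1] at hy; omega).append_right
      ([i + d + 1, i + d + 2] ++ List.range' (i + d + 3) e)
  have p2 : Path [i + d + 2, i + d + 1, i + d + 2] [i + d + 1, i + d + 2, i + d + 1] 1 0 :=
    .braid (Or.inr ⟨[], [], i + d + 1, rfl, rfl⟩) (.refl _)
  have p3 := (Path.cons_comm (i + d + 1) (List.range' (i + d + 3) e) fun y hy => by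
    rw [List.mem_range'_1] at hy; omega).append_left
      (List.range' (i + 1) d ++ [i + d + 1, i + d + 2])
  have p2' := (p2.append_right (List.range' (i + d + 3) e)).append_left (List.range' (i + 1) d)
  have p12 := p1.trans (by simpa using p2')
  have p123 := p12.trans (by simpa using p3)
  refine Path.cast ?_ rfl (by simp; omega : 0 + d + 0 + e = _)
  simpa using p123

theorem path_strand_first {k i : ℕ} {w : List ℕ} (h : Rising k i w) :
    Path w (List.range' (i + 1) (k - i) ++ dec i w) (strandT i w) (strandC k i w) := by
  induction w generalizing i with
  | nil =>
    obtain rfl : i = k := h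
    simpa [dec, strandT, strandC] using Path.refl []
  | cons x w ih =>
    simp only [Rising] at h
    simp only [dec, strandT, strandC]
    split_ifs at h ⊢ with h1 h2 h3
    · have hk := h.le
      rw [show k - i = (k - (i + 1)) + 1 by omega, List.range'_succ, h1]
      exact (ih h).cons (i + 1)
    · exact absurd h2 h.1.2.2
    · have hk := h.2.le
      have p := (Path.cons_comm x (List.range' (i + 1) (k - i)) fun y hy => by
        rw [List.mem_range'_1] at hy; omega).append_right (dec i w)
      have := ((ih h.2).cons x).trans p
      rw [List.length_range'] at this
      have := this.cast (t' := 0 + strandT i w) (c' := k - i + strandC k i w)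
        (by omega) (by omega)
      simpa using this
    · have p := (path_cross (i := i) (k := k) (x := x) (by omega) h.1.2.1).append_right (dec i w)
      have := ((ih h.2).cons x).trans p
      have := this.cast (add_comm _ _) (add_comm _ _)
      simpa using this

/-- The induction carries the part `1, …, i` of the strand already read, and pulls each other letter
of `w` to its left. -/
theorem path_strand_last {k i : ℕ} {w : List ℕ} (h : Rising k i w) :
    ∃ t c, strandT i w + t = (dec i w).length ∧
      strandC k i w + c = (k - 2) * (dec i w).length ∧
      Path (List.range' 1 i ++ w) (shift 1 (dec i w) ++ List.range' 1 k) t c := by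
  induction w generalizing i with
  | nil =>
    obtain rfl : i = k := h
    exact ⟨0, 0, rfl, by simp [strandC, dec], by simpa [dec, shift] using Path.refl _⟩
  | cons x w ih =>
    simp only [Rising] at h
    simp only [dec, strandT, strandC]
    split_ifs at h ⊢ with h1 h2 h3
    · obtain ⟨t, c, ht, hc, p⟩ := ih h
      refine ⟨t, c, ht, hc, ?_⟩
      have e : List.range' 1 (i + 1) ++ w = List.range' 1 i ++ x :: w := by
        rw [← List.range'_append_1, h1, add_comm 1 i]; simp
      rwa [← e]
    · exact absurd h2 h.1.2.2
    · obtain ⟨t, c, ht, hc, p⟩ := ih h.2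
      have hk := h.2.le
      -- A letter below the strand must cross the part already read, at the cost of one braid and `i
      -- - 2` commutations; with the `k - i` counted in `strandC` this makes `k - 2`.
      have p1 := (path_cross (i := 0) (k := i) (x := x + 1) (by omega) (by omega)).symm
      have p2 := (p1.append_right w).trans (p.cons (x + 1))
      refine ⟨1 + t, i - 2 + c, ?_, ?_, ?_⟩
      · simp only [List.length_cons]; omega
      · rw [List.length_cons, Nat.mul_succ]; omega
      · simpa [shift] using p2
    · obtain ⟨t, c, ht, hc, p⟩ := ih h.2
      -- A letter above the strand commutes with all `i` letters read so far; with its `k - i - 2`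
      -- this again makes `k - 2`, and its braid move is already counted in `strandT`.
      have p1 := (Path.cons_comm x (List.range' 1 i) fun y hy => by
        rw [List.mem_range'_1] at hy; omega).symm
      have p2 := (p1.append_right w).trans (p.cons x)
      have e : x - 1 + 1 = x := by omega
      refine ⟨t, i + c, ?_, ?_, ?_⟩
      · simp only [List.length_cons]; omega
      · rw [List.length_cons, Nat.mul_succ]; omega
      · simpa [shift, e] using p2

/-! ### Moves and the strand -/

theorem dec_comm {k i : ℕ} {w v : List ℕ} (h : CommMove w v) (hw : Rising k i w) :
    strandT i v = strandT i w ∧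
      ((CommMove (dec i w) (dec i v) ∧ strandC k i v = strandC k i w) ∨
        (dec i v = dec i w ∧ strandC k i v ≤ strandC k i w + 1)) := by
  obtain ⟨p, q, j, l, hjl, rfl, rfl⟩ := h
  rw [List.append_assoc] at hw
  have hr := hw.of_append
  simp only [List.append_assoc, List.cons_append, List.nil_append]
  simp only [dec_append, strandT_append, strandC_append]
  -- The prefix matters only through the position `s` it gives the strand, so the move may be taken
  -- at the start of the word.
  generalize pos i p = s at hr ⊢
  generalize dec i p = p'
  simp only [List.cons_append, List.nil_append, Rising] at hr
  simp only [dec, strandT, strandC]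
  by_cases hj : j = s + 1
  · rw [if_pos hj] at hr
    have hl : l ≠ s + 1 + 1 := by omega
    rw [if_neg hl] at hr
    have h2 := hr.1.2.2
    have h3 : l ≠ s := by omega
    have hle := hr.2.le
    rcases lt_or_gt_of_ne h3 with h4 | h4
    · have h5 : l < s + 1 := by omega
      simp only [hj, hl, h2, h3, h4, h5, if_true, if_false, true_and]
      omega
    · have h5 : ¬ l < s + 1 := by omega
      simp only [hj, hl, h2, h3, h4.not_gt, h5, if_true, if_false, true_and]
      omega
  rw [if_neg hj] at hr
  have hjs := hr.1.2.2
  by_cases hl : l = s + 1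
  · rw [if_pos hl] at hr
    have h1 : j ≠ s + 1 + 1 := by omega
    have h3 : s ≠ s + 1 := by omega
    have hle := hr.2.le
    rcases lt_or_gt_of_ne hjs with h4 | h4
    · have h5 : j < s + 1 := by omega
      simp only [hj, hl, hjs, h1, h4, h5, if_true, if_false, true_and]
      omega
    · have h5 : ¬ j < s + 1 := by omega
      simp only [hj, hl, hjs, h1, h4.not_gt, h5, if_true, if_false, true_and]
      omega
  rw [if_neg hl] at hr
  have hls := hr.2.1.2.2
  simp only [hj, hl, hjs, hls, if_false]
  -- Letters on opposite sides of the strand are below `s` and above `s + 1`, so they still commute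
  -- after the upper one is lowered.
  refine ⟨by omega, Or.inl ⟨⟨p', dec s q, if j < s then j else j - 1,
    if l < s then l else l - 1, ?_, by simp, by simp⟩, by omega⟩⟩
  split_ifs <;> omega

theorem dec_braid {k i : ℕ} {w v : List ℕ} (h : BraidMove w v) (hw : Rising k i w) :
    strandC k i v = strandC k i w ∧
      ((BraidMove (dec i w) (dec i v) ∧ strandT i v = strandT i w) ∨
        (dec i v = dec i w ∧ strandT i v = strandT i w + 1)) := by
  obtain ⟨p, q, j, rfl, rfl⟩ := h
  rw [List.append_assoc] at hw
  have hr := hw.of_append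
  simp only [List.append_assoc, List.cons_append, List.nil_append]
  simp only [dec_append, strandT_append, strandC_append]
  generalize pos i p = s at hr ⊢
  generalize dec i p = p'
  simp only [List.cons_append, List.nil_append, Rising] at hr
  simp only [dec, strandT, strandC]
  -- This is the only way the strand can take part: it then crosses both others, and the crossing of
  -- those two passes from below it to above it. If the strand does not take part, all three letters
  -- lie on one side of it.
  by_cases hj : j = s + 1
  · subst hj
    simp [show s + 1 + 1 ≠ s by omega, show ¬ s + 1 + 1 < s by omega]
    omega
  rw [if_neg hj] at hr
  have hjs := hr.1.2.2
  have h1 : j + 1 ≠ s + 1 := by omega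
  rw [if_neg h1] at hr
  have h2 := hr.2.1.2.2
  simp only [hj, hjs, h1, h2, if_false]
  rcases lt_or_gt_of_ne hjs with h4 | h4
  · have h5 : j + 1 < s := by omega
    simp only [h4, h5, if_true]
    exact ⟨trivial, Or.inl ⟨⟨p', dec s q, j, by simp, by simp⟩, trivial⟩⟩
  · have h5 : ¬ j + 1 < s := by omega
    simp only [h4.not_gt, h5, if_false]
    exact ⟨trivial, Or.inl ⟨⟨p', dec s q, j - 1, by simp; omega, by simp; omega⟩, trivial⟩⟩

/-! ### The words with extreme strands -/

theorem strand_range' (k i d : ℕ) (u : List ℕ) :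
    pos i (List.range' (i + 1) d ++ u) = pos (i + d) u ∧
    dec i (List.range' (i + 1) d ++ u) = dec (i + d) u ∧
    strandT i (List.range' (i + 1) d ++ u) = strandT (i + d) u ∧
    strandC k i (List.range' (i + 1) d ++ u) = strandC k (i + d) u := by
  induction d generalizing i with
  | zero => simp
  | succ d ih =>
    have := ih (i + 1)
    rw [List.range'_succ]
    simp only [List.cons_append, pos, dec, strandT, strandC, if_true]
    rwa [show i + (d + 1) = i + 1 + d by omega]

theorem strand_of_lt {k : ℕ} {u : List ℕ} (hu : ∀ x ∈ u, x < k) :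
    pos k u = k ∧ dec k u = u ∧ strandT k u = 0 ∧ strandC k k u = 0 := by
  induction u with
  | nil => exact ⟨rfl, rfl, rfl, rfl⟩
  | cons x u ih =>
    have hx := hu x (by simp)
    obtain ⟨h1, h2, h3, h4⟩ := ih fun y hy => hu y (by simp [hy])
    have e1 : x ≠ k + 1 := by omega
    simp only [pos, dec, strandT, strandC, e1, hx.ne, hx, if_true, if_false, h1, h2, h3, h4]
    simp

theorem strand_shift {u : List ℕ} (k : ℕ) (hu : ∀ x ∈ u, 1 ≤ x) :
    pos 0 (shift 1 u) = 0 ∧ dec 0 (shift 1 u) = u ∧ strandT 0 (shift 1 u) = u.length ∧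
      strandC k 0 (shift 1 u) = (k - 2) * u.length := by
  induction u with
  | nil => exact ⟨rfl, rfl, rfl, rfl⟩
  | cons x u ih =>
    have hx := hu x (by simp)
    obtain ⟨h1, h2, h3, h4⟩ := ih fun y hy => hu y (by simp [hy])
    have e : shift 1 (x :: u) = (x + 1) :: shift 1 u := rfl
    have e1 : x + 1 ≠ 0 + 1 := by omega
    have e2 : x + 1 ≠ 0 := by omega
    rw [e]
    simp only [pos, dec, strandT, strandC, e1, e2, not_lt_zero, if_false, h1, h2, h3, h4,
      List.length_cons, Nat.add_sub_cancel, Nat.sub_zero, Nat.mul_succ]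
    refine ⟨trivial, trivial, by omega, by omega⟩

/-! ### Skew sums with a point -/

/-- `π` is the skew sum of `α` and the permutation of size one. -/
structure IsSkewPoint {k n : ℕ} (α : Equiv.Perm (Fin k)) (π : Equiv.Perm (Fin n)) : Prop where
  size : n = k + 1
  left : ∀ (i : Fin k) (j : Fin n), (j : ℕ) = i → (π j : ℕ) = α i + 1
  last : ∀ j : Fin n, (j : ℕ) = k → (π j : ℕ) = 0

namespace IsSkewPoint

variable {k n : ℕ} {α : Equiv.Perm (Fin k)} {π : Equiv.Perm (Fin n)}

/-- The permutation is determined by the final position of the least value and by the action on the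
other strands. -/
theorem isWord_iff_dec (h : IsSkewPoint α π) {w : List ℕ} (hl : ∀ x ∈ w, 1 ≤ x ∧ x < n) :
    IsWord π w ↔ pos 0 w = k ∧ IsWord α (dec 0 w) := by
  have hn := h.size
  obtain ⟨h1, h2⟩ := natProd_skip 0 w fun x hx => (hl x hx).1
  rw [isWord_iff, isWord_iff, and_iff_right hl,
    and_iff_right (dec_bounds (Nat.zero_le k) fun x hx => by have := hl x hx; omega)]
  constructor
  · intro hw
    have hk : pos 0 w = k := by
      apply (natProd w).injective
      rw [h1]
      exact ((hw ⟨k, by omega⟩).trans (h.last _ rfl)).symm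
    refine ⟨hk, fun j => ?_⟩
    have := h2 j
    rw [hk] at this
    simp only [skip, j.2, if_true, not_lt_zero, if_false] at this
    have e := (hw ⟨j, by omega⟩).trans (h.left j _ rfl)
    simp only at e
    omega
  · rintro ⟨hk, hw⟩ j
    rw [hk] at h1 h2
    by_cases hj : (j : ℕ) < k
    · have := h2 j
      simp only [skip, hj, if_true, not_lt_zero, if_false] at this
      rw [h.left ⟨j, hj⟩ j rfl, this, ← hw]
    · have e : (j : ℕ) = k := by omega
      rw [h.last j e, e, h1]

theorem mem_R_of_dec (h : IsSkewPoint α π) {w : List ℕ} (hl : ∀ x ∈ w, 1 ≤ x ∧ x < n)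
    (hpos : pos 0 w = k) (hdec : dec 0 w ∈ R α) (hlen : w.length = k + (dec 0 w).length) :
    w ∈ R π := by
  refine ⟨(h.isWord_iff_dec hl).2 ⟨hpos, hdec.1⟩, fun v hv => ?_⟩
  obtain ⟨h1, h2⟩ := (h.isWord_iff_dec hv.1).1 hv
  have h3 := pos_add_length_dec_le 0 v
  have h4 := len_le_length h2
  have h5 := length_eq_len hdec
  omega

theorem strand_first_mem (h : IsSkewPoint α π) {u : List ℕ} (hu : u ∈ R α) :
    List.range' 1 k ++ u ∈ R π := by
  have hn := h.size
  have hlt : ∀ x ∈ u, x < k := fun x hx => (hu.1.1 x hx).2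
  obtain ⟨h1, h2, -⟩ := strand_range' k 0 k u
  obtain ⟨h3, h4, -⟩ := strand_of_lt hlt
  rw [zero_add, zero_add] at h1 h2
  refine h.mem_R_of_dec (fun x hx => ?_) (h1.trans h3) (by rwa [h2, h4]) (by simp [h2, h4])
  rcases List.mem_append.1 hx with hx | hx
  · rw [List.mem_range'_1] at hx; omega
  · have := hu.1.1 x hx; omega

theorem strand_last_mem (h : IsSkewPoint α π) {u : List ℕ} (hu : u ∈ R α) :
    shift 1 u ++ List.range' 1 k ∈ R π := by
  have hn := h.size
  have hpos : ∀ x ∈ u, 1 ≤ x := fun x hx => (hu.1.1 x hx).1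
  obtain ⟨h1, h2, -⟩ := strand_range' k 0 k []
  obtain ⟨h3, h4, -⟩ := strand_shift k hpos
  rw [zero_add, zero_add, List.append_nil] at h1 h2
  have hd : dec 0 (shift 1 u ++ List.range' 1 k) = u := by
    rw [dec_append, h3, h2, h4]; simp [dec]
  refine h.mem_R_of_dec (fun x hx => ?_) (by rw [pos_append, h3, h1]; rfl) (by rwa [hd])
    (by rw [hd]; simp [shift, add_comm])
  rcases List.mem_append.1 hx with hx | hx
  · obtain ⟨y, hy, rfl⟩ := List.mem_map.1 hx
    have := hu.1.1 y hy; omega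
  · rw [List.mem_range'_1] at hx; omega

theorem len_eq (h : IsSkewPoint α π) {u : List ℕ} (hu : u ∈ R α) : len π = len α + k := by
  rw [← length_eq_len (h.strand_first_mem hu), ← length_eq_len hu]
  simp [add_comm]

/-- At minimal length the strand spends exactly `k` letters, so it never moves to the left, and the
rest is a shortest word for `α`. -/
theorem mem_R (h : IsSkewPoint α π) (hlen : len π = len α + k) {v : List ℕ} (hv : v ∈ R π) :
    Rising k 0 v ∧ dec 0 v ∈ R α := by
  have hn := h.size
  obtain ⟨h1, h2⟩ := (h.isWord_iff_dec hv.1.1).1 hv.1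
  have h3 := pos_add_length_dec_le 0 v
  have h4 := len_le_length h2
  have h5 := length_eq_len hv
  exact ⟨rising_of_length_le (fun x hx => by have := hv.1.1 x hx; omega) h1 (by omega),
    mem_R_of_length_le h2 (by omega)⟩

end IsSkewPoint

/-- The grading of the skew sum with a point. -/
def Grading.skewPoint {k n : ℕ} {α : Equiv.Perm (Fin k)} {π : Equiv.Perm (Fin n)} {T D : ℕ}
    (h : IsSkewPoint α π) (g : Grading α T D) : Grading π (T + len α) (D + (k - 2) * len α) where
  t v := g.t (dec 0 v) + strandT 0 v
  c v := g.c (dec 0 v) + strandC k 0 v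
  bot := List.range' 1 k ++ g.bot
  top := shift 1 g.top ++ List.range' 1 k
  bot_mem := h.strand_first_mem g.bot_mem
  top_mem := h.strand_last_mem g.top_mem
  path_bot v hv := by
    obtain ⟨h1, h2⟩ := h.mem_R (h.len_eq g.bot_mem) hv
    exact ((path_strand_first h1).trans ((g.path_bot _ h2).append_left _)).cast
      (add_comm _ _) (add_comm _ _)
  path_top v hv := by
    obtain ⟨h1, h2⟩ := h.mem_R (h.len_eq g.bot_mem) hv
    obtain ⟨t, c, ht, hc, p⟩ := path_strand_last h1
    obtain ⟨t', c', ht', hc', p'⟩ := g.path_top _ h2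
    rw [length_eq_len h2] at ht hc
    exact ⟨_, _, by omega, by omega, p.trans ((p'.shift 1).append_right _)⟩
  comm w hw v hv hwv := by
    obtain ⟨h1, h2⟩ := h.mem_R (h.len_eq g.bot_mem) hw
    obtain ⟨-, h2'⟩ := h.mem_R (h.len_eq g.bot_mem) hv
    obtain ⟨h3, ⟨h4, h5⟩ | ⟨h4, h5⟩⟩ := dec_comm hwv h1
    · have := g.comm _ h2 _ h2' h4
      omega
    · rw [h4]; omega
  braid w hw v hv hwv := by
    obtain ⟨h1, h2⟩ := h.mem_R (h.len_eq g.bot_mem) hw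
    obtain ⟨-, h2'⟩ := h.mem_R (h.len_eq g.bot_mem) hv
    obtain ⟨h3, ⟨h4, h5⟩ | ⟨h4, h5⟩⟩ := dec_braid hwv h1
    · have := g.braid _ h2 _ h2' h4
      omega
    · rw [h4]; omega
  t_bot := by
    obtain ⟨-, h1, h2, -⟩ := strand_range' k 0 k g.bot
    obtain ⟨-, h3, h4, -⟩ := strand_of_lt fun x hx => (g.bot_mem.1.1 x hx).2
    rw [zero_add, zero_add] at h1 h2
    rw [h1, h2, h3, h4, g.t_bot]
  c_bot := by
    obtain ⟨-, h1, -, h2⟩ := strand_range' k 0 k g.bot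
    obtain ⟨-, h3, -, h4⟩ := strand_of_lt fun x hx => (g.bot_mem.1.1 x hx).2
    rw [zero_add, zero_add] at h1 h2
    rw [h1, h2, h3, h4, g.c_bot]
  t_top := by
    obtain ⟨-, h1, h2, -⟩ := strand_range' k 0 k []
    obtain ⟨h5, h3, h4, -⟩ := strand_shift k fun x hx => (g.top_mem.1.1 x hx).1
    rw [zero_add, zero_add, List.append_nil] at h1 h2
    rw [dec_append, strandT_append, h5, h1, h2, h3, h4, ← length_eq_len g.top_mem]
    simp [dec, strandT, g.t_top]
  c_top := by
    obtain ⟨-, h1, -, h2⟩ := strand_range' k 0 k []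
    obtain ⟨h5, h3, -, h4⟩ := strand_shift k fun x hx => (g.top_mem.1.1 x hx).1
    rw [zero_add, zero_add, List.append_nil] at h1 h2
    rw [dec_append, strandC_append, h5, h1, h2, h3, h4, ← length_eq_len g.top_mem]
    simp [dec, strandC, g.c_top]

end WordGraph

namespace WordGraph

/-! ### The decomposition of a permutation that avoids `312` -/

theorem Avoids.of_embedding {k l n : ℕ} {π : Equiv.Perm (Fin n)} {σ : Equiv.Perm (Fin k)}
    {τ : Equiv.Perm (Fin l)} (h : Avoids π τ) (f : Fin k ↪o Fin n)
    (hf : ∀ i j, π (f i) ≤ π (f j) ↔ σ i ≤ σ j) : Avoids σ τ := by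
  rintro ⟨e, he⟩
  exact h ⟨e.trans f, fun i j => (hf _ _).trans (he i j)⟩

/-- A permutation with prescribed values. -/
theorem exists_perm_val {a : ℕ} (f : Fin a → ℕ) (hf : ∀ i, f i < a)
    (hinj : Function.Injective f) : ∃ σ : Equiv.Perm (Fin a), ∀ i, (σ i : ℕ) = f i := by
  have hb : Function.Bijective fun i => (⟨f i, hf i⟩ : Fin a) :=
    Finite.injective_iff_bijective.1 fun i j hij => hinj (by simpa using hij)
  exact ⟨Equiv.ofBijective _ hb, fun i => rfl⟩

/-- Otherwise the entries at `i`, `z`, `j` form the pattern `312`. -/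
theorem lt_of_avoids {n : ℕ} {π : Equiv.Perm (Fin n)} (hπ : Avoids π perm312) {i j z : Fin n}
    (hz : (π z : ℕ) = 0) (hi : i < z) (hj : z < j) : π i < π j := by
  by_contra hij
  apply hπ
  have hij : π j < π i := lt_of_le_of_ne (not_lt.1 hij)
    (π.injective.ne (hi.trans hj).ne')
  have hzj : π z < π j := by
    rw [Fin.lt_def, hz]
    have : π z ≠ π j := π.injective.ne hj.ne
    rw [Ne, Fin.ext_iff] at this
    omega
  have hmono : StrictMono ![i, z, j] := by
    rw [Fin.strictMono_iff_lt_succ]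
    intro x
    fin_cases x
    · exact hi
    · exact hj
  refine ⟨OrderEmbedding.ofStrictMono _ hmono, fun x y => ?_⟩
  have hzi := hzj.trans hij
  fin_cases x <;> fin_cases y <;>
    simp [perm312, hij.le, hzj.le, hzi.le, hij, hzj, hzi]

/-- In a permutation that avoids `312`, the entries before and at the least one are smaller than
those after it. -/
theorem exists_decomposition {n k : ℕ} (hk : k + 1 ≤ n) {π : Equiv.Perm (Fin n)}
    (hπ : Avoids π perm312) (hz : (π ⟨k, by omega⟩ : ℕ) = 0) :
    ∃ (π' : Equiv.Perm (Fin k)) (π'' : Equiv.Perm (Fin (n - (k + 1)))),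
      Avoids π' perm312 ∧ Avoids π'' perm312 ∧
      (∀ (i : Fin k) (j : Fin n), (j : ℕ) = i → (π j : ℕ) = π' i + 1) ∧
      (∀ (i : Fin (n - (k + 1))) (j : Fin n), (j : ℕ) = k + 1 + i →
        (π j : ℕ) = k + 1 + π'' i) := by
  have hpos : ∀ j : Fin n, (j : ℕ) ≠ k → 0 < (π j : ℕ) := by
    intro j hj
    by_contra h
    have : π j = π ⟨k, by omega⟩ := Fin.ext (by omega)
    exact hj (congrArg Fin.val (π.injective this))
  have hlt : ∀ i j : Fin n, (i : ℕ) ≤ k → k < (j : ℕ) → π i < π j := by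
    intro i j hi hj
    rcases hi.lt_or_eq with hi | hi
    · exact lt_of_avoids hπ hz (z := ⟨k, by omega⟩) hi hj
    · have e : i = ⟨k, by omega⟩ := Fin.ext hi
      rw [e, Fin.lt_def, hz]
      exact hpos j (by omega)
  have hsmall : ∀ i : Fin n, (i : ℕ) ≤ k → (π i : ℕ) ≤ k := by
    intro i hi
    -- Values up to `π i` occur only at positions up to `k`, so there are at most `k + 1` of them.
    have hsub : (Finset.Iic (π i)).map π.symm.toEmbedding ⊆
        Finset.Iic (⟨k, by omega⟩ : Fin n) := by
      intro x hx
      rw [Finset.mem_map] at hx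
      obtain ⟨y, hy, rfl⟩ := hx
      rw [Finset.mem_Iic] at hy ⊢
      by_contra hc
      have := hlt i (π.symm y) hi (by simpa [Fin.le_def] using hc)
      rw [Equiv.apply_symm_apply] at this
      exact absurd hy (not_le.2 this)
    have := Finset.card_le_card hsub
    rw [Finset.card_map, Fin.card_Iic, Fin.card_Iic] at this
    simpa using this
  have hlarge : ∀ j : Fin n, k < (j : ℕ) → k < (π j : ℕ) := by
    intro j hj
    -- Dually, the `k + 1` entries at positions up to `k` all lie below `π j`.
    have hsub : (Finset.Iic (⟨k, by omega⟩ : Fin n)).map π.toEmbedding ⊆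
        Finset.Iio (π j) := by
      intro x hx
      rw [Finset.mem_map] at hx
      obtain ⟨y, hy, rfl⟩ := hx
      rw [Finset.mem_Iic] at hy
      exact Finset.mem_Iio.2 (hlt y j hy hj)
    have := Finset.card_le_card hsub
    rw [Finset.card_map, Fin.card_Iic, Fin.card_Iio] at this
    simpa using this
  let e : Fin k ↪o Fin n := Fin.castLEOrderEmb (by omega)
  let e' : Fin (n - (k + 1)) ↪o Fin n :=
    OrderEmbedding.ofStrictMono (fun i => ⟨k + 1 + i, by omega⟩) fun i j hij => by
      rw [Fin.lt_def] at hij ⊢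
      exact Nat.add_lt_add_left hij _
  have he : ∀ i, (e i : ℕ) = i := fun _ => rfl
  have he' : ∀ i, (e' i : ℕ) = k + 1 + i := fun _ => rfl
  have h1 : ∀ i, 0 < (π (e i) : ℕ) ∧ (π (e i) : ℕ) ≤ k := fun i =>
    ⟨hpos _ (by rw [he]; omega), hsmall _ (by rw [he]; omega)⟩
  have h2 : ∀ i, k < (π (e' i) : ℕ) := fun i => hlarge _ (by rw [he']; omega)
  obtain ⟨π', hπ'⟩ := exists_perm_val (fun i => (π (e i) : ℕ) - 1)
    (fun i => by have := h1 i; omega) (fun i j hij => by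
      have hi := h1 i
      have hj := h1 j
      exact e.injective (π.injective (Fin.ext (by dsimp only at hij; omega))))
  obtain ⟨π'', hπ''⟩ := exists_perm_val (fun i => (π (e' i) : ℕ) - (k + 1))
    (fun i => by have := h2 i; omega) (fun i j hij => by
      have hi := h2 i
      have hj := h2 j
      exact e'.injective (π.injective (Fin.ext (by dsimp only at hij; omega))))
  refine ⟨π', π'', hπ.of_embedding e fun i j => ?_, hπ.of_embedding e' fun i j => ?_,
    fun i j hij => ?_, fun i j hij => ?_⟩
  · rw [Fin.le_def, Fin.le_def, hπ', hπ']
    have := h1 i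
    have := h1 j
    omega
  · rw [Fin.le_def, Fin.le_def, hπ'', hπ'']
    have := h2 i
    have := h2 j
    omega
  · obtain rfl : j = e i := Fin.ext hij
    rw [hπ']
    have := h1 i
    omega
  · obtain rfl : j = e' i := Fin.ext hij
    rw [hπ'']
    have := h2 i
    omega

/-! ### The inflations as direct and skew sums -/

theorem isSum_inflate12 {a b : ℕ} (α : Equiv.Perm (Fin a)) (β : Equiv.Perm (Fin b)) :
    IsSum α β (inflate12 α β) where
  size := rfl
  left i j hij := by
    obtain rfl : j = Fin.castAdd b i := Fin.ext hij
    simp [inflate12]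
  right i j hij := by
    obtain rfl : j = Fin.natAdd a i := Fin.ext hij
    simp [inflate12]

theorem isSkewPoint_inflate21 {k : ℕ} (α : Equiv.Perm (Fin k)) :
    IsSkewPoint α (inflate21 α (1 : Equiv.Perm (Fin 1))) where
  size := rfl
  left i j hij := by
    obtain rfl : j = Fin.castAdd 1 i := Fin.ext hij
    simp [inflate21, add_comm]
  last j hj := by
    obtain rfl : j = Fin.natAdd k 0 := Fin.ext hj
    simp [inflate21]

theorem IsSum.resize {a b n : ℕ} {α : Equiv.Perm (Fin a)} {β : Equiv.Perm (Fin b)}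
    (h : a + b = n) : IsSum α β (resize h (inflate12 α β)) := by
  subst h
  exact isSum_inflate12 α β

/-- A permutation that avoids `312` is `12[21[π', 1], π'']`. -/
theorem eq_resize_inflate {n k : ℕ} (h : k + 1 + (n - (k + 1)) = n) {π : Equiv.Perm (Fin n)}
    (hz : (π ⟨k, by omega⟩ : ℕ) = 0) {π' : Equiv.Perm (Fin k)}
    {π'' : Equiv.Perm (Fin (n - (k + 1)))}
    (h' : ∀ (i : Fin k) (j : Fin n), (j : ℕ) = i → (π j : ℕ) = π' i + 1)
    (h'' : ∀ (i : Fin (n - (k + 1))) (j : Fin n), (j : ℕ) = k + 1 + i →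
        (π j : ℕ) = k + 1 + π'' i) :
    π = resize h (inflate12 (inflate21 π' (1 : Equiv.Perm (Fin 1))) π'') := by
  have hs : IsSum (inflate21 π' (1 : Equiv.Perm (Fin 1))) π'' _ := IsSum.resize h
  have hp := isSkewPoint_inflate21 π'
  ext j
  rcases lt_trichotomy (j : ℕ) k with hj | hj | hj
  · rw [hs.left ⟨j, by omega⟩ j rfl, hp.left ⟨j, hj⟩ _ rfl, h' ⟨j, hj⟩ j rfl]
  · have e : j = ⟨k, by omega⟩ := Fin.ext hj
    rw [e, hs.left ⟨k, by omega⟩ _ rfl, hp.last _ rfl, hz]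
  · have e : (j : ℕ) = k + 1 + (j - (k + 1) : ℕ) := by omega
    rw [hs.right ⟨j - (k + 1), by omega⟩ j e, h'' ⟨j - (k + 1), by omega⟩ j e]

/-! ### Gradings for permutations that avoid `312` -/

theorem nil_mem_R (π : Equiv.Perm (Fin 0)) : [] ∈ R π :=
  ⟨⟨by simp, Subsingleton.elim _ _⟩, fun _ _ => Nat.zero_le _⟩

/-- The grading of the empty permutation. -/
def Grading.empty (π : Equiv.Perm (Fin 0)) : Grading π 0 0 where
  t _ := 0
  c _ := 0
  bot := []
  top := []
  bot_mem := nil_mem_R π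
  top_mem := nil_mem_R π
  path_bot v hv := by
    obtain rfl : v = [] := List.eq_nil_of_length_eq_zero
      (Nat.le_zero.1 (hv.2 [] (nil_mem_R π).1))
    exact .refl _
  path_top v hv := by
    obtain rfl : v = [] := List.eq_nil_of_length_eq_zero
      (Nat.le_zero.1 (hv.2 [] (nil_mem_R π).1))
    exact ⟨0, 0, rfl, rfl, .refl _⟩
  comm _ _ _ _ _ := by simp
  braid _ _ _ _ _ := by simp
  t_bot := rfl
  c_bot := rfl
  t_top := rfl
  c_top := rfl

/-- The grading of `12[21[π', 1], π'']`. -/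
noncomputable def Grading.inflate {n k b : ℕ} (h : k + 1 + b = n) {π' : Equiv.Perm (Fin k)}
    {π'' : Equiv.Perm (Fin b)} {T D T' D' : ℕ} (g : Grading π' T D) (g' : Grading π'' T' D') :
    Grading (resize h (inflate12 (inflate21 π' (1 : Equiv.Perm (Fin 1))) π''))
      (T + len π' + T') (D + (k - 2) * len π' + D' + (len π' + k) * len π'') :=
  have hp := isSkewPoint_inflate21 π'
  -- The rewriting replaces the length of `21[π', 1]` by `len π' + k`.
  hp.len_eq g.bot_mem ▸ (g.skewPoint hp).sum (IsSum.resize h) g'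

theorem exists_grading {n : ℕ} (π : Equiv.Perm (Fin n)) (hπ : Avoids π perm312) :
    ∃ T D, Nonempty (Grading π T D) := by
  induction n using Nat.strong_induction_on with
  | _ n ih =>
    rcases Nat.eq_zero_or_pos n with rfl | hn
    · exact ⟨0, 0, ⟨.empty π⟩⟩
    obtain ⟨k, hk⟩ : ∃ k, k = π.symm ⟨0, hn⟩ := ⟨_, rfl⟩
    have hz : (π k : ℕ) = 0 := by rw [hk, Equiv.apply_symm_apply]
    obtain ⟨π', π'', hπ', hπ'', h', h''⟩ := exists_decomposition (k := k) (by omega) hπ hz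
    obtain ⟨T, D, ⟨g⟩⟩ := ih k k.2 π' hπ'
    obtain ⟨T', D', ⟨g'⟩⟩ := ih _ (by omega) π'' hπ''
    rw [eq_resize_inflate (by omega) hz h' h'']
    exact ⟨_, _, ⟨g.inflate (by omega) g'⟩⟩

/-- A permutation of size at most one has length zero. -/
theorem sub_two_mul_len {k : ℕ} {π : Equiv.Perm (Fin k)} {T D : ℕ} (g : Grading π T D) :
    (((k - 2) * len π : ℕ) : ℤ) = ((k : ℤ) - 2) * len π := by
  rcases Nat.lt_or_ge k 2 with hk | hk
  · have : g.bot = [] := List.eq_nil_iff_forall_not_mem.2 fun x hx => by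
      have := g.bot_mem.1.1 x hx
      omega
    rw [← length_eq_len g.bot_mem, this]
    simp
  · push_cast [hk]
    ring

end WordGraph

/-! ### The diameter formulas -/

theorem theorem5p3 (n m : ℕ) (hm1 : 1 ≤ m) (hmn : m ≤ n) (π : Equiv.Perm (Fin n))
    (hπ : WordGraph.Avoids π WordGraph.perm312)
    (hm : π ⟨m - 1, by omega⟩ = ⟨0, by omega⟩) :
    ∃ (π' : Equiv.Perm (Fin (m - 1))) (π'' : Equiv.Perm (Fin (n - m))),
      WordGraph.Avoids π' WordGraph.perm312 ∧
      WordGraph.Avoids π'' WordGraph.perm312 ∧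
      π = WordGraph.resize (by omega : (m - 1 + 1) + (n - m) = n)
        (WordGraph.inflate12
          (WordGraph.inflate21 π' (1 : Equiv.Perm (Fin 1))) π'') ∧
      WordGraph.GraphsConnected π ∧
      WordGraph.GraphsConnected π' ∧
      WordGraph.GraphsConnected π'' ∧
      ((WordGraph.G π).diam : ℤ) =
        (WordGraph.G π').diam + (WordGraph.G π'').diam
          + ((m : ℤ) - 1) * ((WordGraph.len π' : ℤ) + WordGraph.len π'')
          + (WordGraph.len π' : ℤ) * ((WordGraph.len π'' : ℤ) - 1) ∧
      (WordGraph.C π).diam =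
        (WordGraph.C π').diam + (WordGraph.C π'').diam + WordGraph.len π' ∧
      ((WordGraph.B π).diam : ℤ) =
        (WordGraph.B π').diam + (WordGraph.B π'').diam
          + ((m : ℤ) - 1) * ((WordGraph.len π' : ℤ) + WordGraph.len π'')
          + (WordGraph.len π' : ℤ) * ((WordGraph.len π'' : ℤ) - 2) := by
  obtain ⟨k, rfl⟩ : ∃ k, m = k + 1 := ⟨m - 1, by omega⟩
  have hz : (π ⟨k, by omega⟩ : ℕ) = 0 := congrArg Fin.val hm
  obtain ⟨π', π'', hπ', hπ'', h', h''⟩ := WordGraph.exists_decomposition hmn hπ hz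
  have hdec := WordGraph.eq_resize_inflate (by omega) hz h' h''
  obtain ⟨T, D, ⟨g⟩⟩ := WordGraph.exists_grading π' hπ'
  obtain ⟨T', D', ⟨g'⟩⟩ := WordGraph.exists_grading π'' hπ''
  have gπ := g.inflate (by omega : k + 1 + (n - (k + 1)) = n) g'
  rw [← hdec] at gπ
  -- The grading has the truncated `k - 2`, whereas the formulas are over the integers; with `k = m
  -- - 1` its terms regroup as `(m - 1)(ℓ' + ℓ'') + ℓ'(ℓ'' - 2)`, where `ℓ'` and `ℓ''` are the
  -- lengths of `π'` and `π''`.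
  have hlen := WordGraph.sub_two_mul_len g
  refine ⟨π', π'', hπ', hπ'', hdec, gπ.graphsConnected, g.graphsConnected, g'.graphsConnected,
    ?_, ?_, ?_⟩
  · rw [gπ.G_connected_and_diam.2]
    erw [g.G_connected_and_diam.2, g'.G_connected_and_diam.2]
    rw [Nat.cast_add, Nat.cast_add, Nat.cast_add, Nat.cast_add, Nat.cast_add, Nat.cast_add, hlen]
    push_cast
    ring
  · rw [gπ.C_connected_and_diam.2]
    erw [g.C_connected_and_diam.2, g'.C_connected_and_diam.2]
    ring
  · rw [gπ.B_connected_and_diam.2]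
    erw [g.B_connected_and_diam.2, g'.B_connected_and_diam.2]
    rw [Nat.cast_add, Nat.cast_add, Nat.cast_add, hlen]
    push_cast
    ring
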